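/- Let $X\subset\mathbb R^d$ be compact, let $\alpha\in(0,1)$, $\gamma\in[0,1]$, $c>0$, and let $p,g:X\to\mathbb R$ be upper semicontinuous probability densities (with respect to Lebesgue measure on $X$) with positive lower bounds. Let $\mathcal D(X)$ be the set of bounded measurable functions $q:X\to\mathbb R$ with a positive lower bound (content densities, not necessarily normalized). A compensation scheme is a function $W:X\times\mathcal D(X)\to\mathbb R_{\ge0}$; it is $X$-based if $W(x;q)$ does not depend on $q$. For $q\in\mathcal D(X)$ put $$V^W(y;q)=(1-\gamma)\Big(\frac{p(y)}{q(y)}\Big)^{\alpha}+W(y;q),\qquad U^W(x;q)=V^W(x;q)-c,\qquad V^W(g;q)=\int_X V^W(y;q)\,g(y)\,dy,$$ and let the platform's profit be $$\Pi^W(q)=\gamma\int_X p(x)^\alpha q(x)^{1-\alpha}\,dx-\int_X W(x;q)\,q(x)\,dx .$$ A mean field equilibrium under $W$ is a pair $(\beta,q)$ of a measurable map $\beta=(\beta_{\rm H},\beta_{\rm AI},\beta_{\rm O}):X\to\Delta\{{\rm H},{\rm AI},{\rm O}\}$ and a $q\in\mathcal D(X)$ such that $V^W(\cdot\,;q)\,g$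 is integrable, for every $x\in X$ the vector $\beta(x)$ maximizes $b\mapsto b_{\rm H}U^W(x;q)+b_{\rm AI}V^W(g;q)$ over the simplex $\Delta\{{\rm H},{\rm AI},{\rm O}\}$, and $$q(x)=\beta_{\rm H}(x)p(x)+g(x)\int_X\beta_{\rm AI}(y)p(y)\,dy\qquad\text{for all }x\in X .$$ Let $r(x)=p(x)/g(x)$. Suppose that the distribution of $r(x)$ for $x\sim p$ has a density with respect to Lebesgue measure on $\mathbb R$ (in particular it is atomless), and that $\gamma\le\frac{2\alpha}{\alpha+1}$. Then for every compensation scheme $\widetilde W$ and every equilibrium $(\tilde\beta,\tilde q)$ under $\widetilde W$ there are $\underline r\in[\inf_X r,\sup_X r]$ and $w\ge0$ such that the $X$-based scheme $$W(x;q)=W(x)=w\cdot\mathbf 1[r(x)\ge\underline r]$$ has an equilibrium $(\beta,q)$ with $\Pi^W(q)\ge\Pi^{\widetilde W}(\tilde q)$. Moreover, if $r$ is upper semicontinuous (for instance, if $g$ is continuous), then $q$ can be taken upper semicontinuous. -/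

import Mathlib

open MeasureTheory
open scoped NNReal

attribute [local instance] Measure.Subtype.measureSpace

namespace ContentPlatform

noncomputable section

/-- The three creation actions: manual creation, use of GenAI, outside option. -/
inductive CreationAction where
  | H
  | AI
  | O

instance : Fintype CreationAction where
  elems := ⟨[CreationAction.H, CreationAction.AI, CreationAction.O], by simp⟩
  complete := by intro a; cases a <;> simp

variable {d : ℕ}

/-- The space `𝒫(X)`: upper semicontinuous probability densities (with respect to Lebesgue
measure on `X`) with a positive lower bound. -/
structure IsProbDensity {X : Set (EuclideanSpace ℝ (Fin d))} (f : X → ℝ) : Prop where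
  upperSemicontinuous : UpperSemicontinuous f
  lower_bound : ∃ m : ℝ, 0 < m ∧ ∀ x, m ≤ f x
  integral_eq_one : ∫ x, f x = 1

/-- The space `𝒟(X)` of content densities, not necessarily normalized: bounded measurable
functions with a positive lower bound. -/
def ContentDensity (X : Set (EuclideanSpace ℝ (Fin d))) : Type :=
  {q : X → ℝ // Measurable q ∧ (∃ m : ℝ, 0 < m ∧ ∀ x, m ≤ q x) ∧ ∃ b : ℝ, ∀ x, q x ≤ b}

instance (X : Set (EuclideanSpace ℝ (Fin d))) : CoeFun (ContentDensity X) (fun _ => X → ℝ) :=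
  ⟨fun q => q.1⟩

/-- A compensation scheme `W : X × 𝒟(X) → ℝ≥0`. -/
abbrev CompensationScheme (X : Set (EuclideanSpace ℝ (Fin d))) : Type :=
  X → ContentDensity X → ℝ≥0

/-- An `X`-based scheme: the compensation does not depend on the content density. -/
def IsXBased {X : Set (EuclideanSpace ℝ (Fin d))} (W : CompensationScheme X) : Prop :=
  ∀ (x : X) (q q' : ContentDensity X), W x q = W x q'

/-- The ratio `r = p / g`. -/
def ratio {X : Set (EuclideanSpace ℝ (Fin d))} (p g : X → ℝ) (x : X) : ℝ := p x / g x

/-- The distribution on `X` with density `f`. -/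
def densityMeasure {X : Set (EuclideanSpace ℝ (Fin d))} (f : X → ℝ) : Measure X :=
  volume.withDensity (fun x => ENNReal.ofReal (f x))

/-- The creator's revenue `V(y;q) = (1-γ) (p(y)/q(y))^α`. -/
def revenue {X : Set (EuclideanSpace ℝ (Fin d))} (p : X → ℝ) (α γ : ℝ)
    (q : ContentDensity X) (y : X) : ℝ :=
  (1 - γ) * (p y / q y) ^ α

/-- The compensated revenue `V^W(y;q) = V(y;q) + W(y;q)`. -/
def compensatedRevenue {X : Set (EuclideanSpace ℝ (Fin d))} (p : X → ℝ) (α γ : ℝ)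
    (W : CompensationScheme X) (q : ContentDensity X) (y : X) : ℝ :=
  revenue p α γ q y + W y q

/-- The profit from manual creation, `U^W(x;q) = V^W(x;q) - c`. -/
def manualProfit {X : Set (EuclideanSpace ℝ (Fin d))} (p : X → ℝ) (α γ c : ℝ)
    (W : CompensationScheme X) (q : ContentDensity X) (x : X) : ℝ :=
  compensatedRevenue p α γ W q x - c

/-- The profit from GenAI, `V^W(g;q) = ∫ V^W(y;q) g(y) dy`. -/
def aiProfit {X : Set (EuclideanSpace ℝ (Fin d))} (p g : X → ℝ) (α γ : ℝ)
    (W : CompensationScheme X) (q : ContentDensity X) : ℝ :=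
  ∫ y, compensatedRevenue p α γ W q y * g y

/-- The expected profit of creator `x` from the mixed action `b`; the outside option yields `0`. -/
def creatorProfit {X : Set (EuclideanSpace ℝ (Fin d))} (p g : X → ℝ) (α γ c : ℝ)
    (W : CompensationScheme X) (q : ContentDensity X) (x : X) (b : CreationAction → ℝ) : ℝ :=
  b CreationAction.H * manualProfit p α γ c W q x + b CreationAction.AI * aiProfit p g α γ W q

/-- The pair `(β, q)` is a mean field equilibrium under `W`. The mixed actions on `CreationAction` are
the points of `stdSimplex ℝ CreationAction`. -/
structure IsEquilibrium {X : Set (EuclideanSpace ℝ (Fin d))} (p g : X → ℝ) (α γ c : ℝ)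
    (W : CompensationScheme X) (β : X → CreationAction → ℝ) (q : ContentDensity X) : Prop where
  /-- The strategy is measurable. -/
  measurable : Measurable β
  /-- The expected profit from GenAI is well defined and finite. -/
  integrable : Integrable (fun y => compensatedRevenue p α γ W q y * g y)
  /-- Every creator plays a mixed action. -/
  mem_simplex : ∀ x, β x ∈ stdSimplex ℝ CreationAction
  /-- Every creator maximizes expected profit. -/
  optimal : ∀ x, IsMaxOn (creatorProfit p g α γ c W q x) (stdSimplex ℝ CreationAction) (β x)
  /-- The content density is the one generated by the strategy. -/
  consistent : ∀ x, q x = β x CreationAction.H * p x + g x * ∫ y, β y CreationAction.AI * p y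

/-- The platform's profit per consumer,
`Π^W(q) = γ ∫ p^α q^(1-α) dx - ∫ W(x;q) q(x) dx`. -/
def platformProfit {X : Set (EuclideanSpace ℝ (Fin d))} (p : X → ℝ) (α γ : ℝ)
    (W : CompensationScheme X) (q : ContentDensity X) : ℝ :=
  γ * (∫ x, p x ^ α * q x ^ (1 - α)) - ∫ x, (W x q : ℝ) * q x

end

end ContentPlatform

open ContentPlatform

/-!
Under the distribution `ν` with density `g` the ratio `r = p / g` is an atomless random variable
of mean `1`, and everything depends on `r` and on the content density relative to `g`, which has
the form `b r + a` with `b` the manual creation and `a` the share of GenAI. As `γ < 1`, GenAI is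
profitable, so that the outside option is never used, and creators earn at least `θ`, the profit
from GenAI plus `c`, wherever they create manually. The platform's profit is then at most the
quality `∫ r ^ α (b r + a) ^ (1 - α) dν` minus `θ - c a`.

For a given share `a`, let the set `b > 0` be replaced by an upper level set `r ≥ ρ` of the same
`ν`-mass, and the density on it by a multiple `k r` of `r`. Concavity and a bathtub argument show
that the quality does not decrease (`IsAtomlessRatio.integral_quality_le`), and the profit from
GenAI does not increase (`IsAtomlessRatio.belowMoment_le_setIntegral`). The result is the
equilibrium of a threshold scheme (`exists_equilibrium_of_profile`) if `a ≤ k ρ` (manual creation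
is nonnegative), `k ≤ 1` (it does not exceed the mass of creators), and GenAI is optimal below
`ρ`.

Optimality of GenAI is reached by lowering `ρ`, which improves both the quality and the cost until
`a = k ρ`; a lower `ρ` is raised to this value, where the quality for the share `a` is largest. If
GenAI is not optimal below `ρ` even then, the equilibrium without compensation and with a smaller
share of GenAI has a higher quality, and it costs nothing
(`IsAtomlessRatio.exists_uncompensated_profile`).

If `k > 1`, the content below `ρ` is under-provided. The profit is then maximized over the pairs
`(a, ρ)` with `k ≥ 1`. Raising `a` and lowering `ρ` both preserve the other constraints, and the
two first-order conditions contradict each other when `γ ≤ 2α / (α + 1)`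
(`firstOrder_incompatible`), so that the maximum has `k = 1`
(`IsAtomlessRatio.exists_profile_level_one`).

The content density of a threshold equilibrium is `k p` for `r ≥ ρ` and `a g` for `r < ρ`, with
`a g ≤ k p` for `r ≥ ρ`, which is upper semicontinuous if `p`, `g` and `r` are.
-/

/-! ### Inequalities for real powers -/

/-- The tangent plane of the Cobb–Douglas function `t ^ α * h ^ (1 - α)` along the ray `h = k t`. -/
theorem rpow_mul_rpow_le_tangent {α t h k : ℝ} (hα : α ∈ Set.Ioo (0 : ℝ) 1) (ht : 0 ≤ t)
    (hh : 0 ≤ h) (hk : 0 < k) :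
    t ^ α * h ^ (1 - α) ≤ α * k ^ (1 - α) * t + (1 - α) * k ^ (-α) * h := by
  obtain ⟨h0, h1⟩ := hα
  have key := Real.geom_mean_le_arith_mean2_weighted h0.le (by linarith : 0 ≤ 1 - α)
    (mul_nonneg (Real.rpow_nonneg hk.le (1 - α)) ht)
    (mul_nonneg (Real.rpow_nonneg hk.le (-α)) hh) (by ring)
  rw [Real.mul_rpow (Real.rpow_nonneg hk.le _) ht, Real.mul_rpow (Real.rpow_nonneg hk.le _) hh,
    ← Real.rpow_mul hk.le, ← Real.rpow_mul hk.le] at key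
  have e : k ^ ((1 - α) * α) * k ^ (-α * (1 - α)) = 1 := by
    rw [← Real.rpow_add hk, show (1 - α) * α + -α * (1 - α) = 0 by ring, Real.rpow_zero]
  calc t ^ α * h ^ (1 - α)
      = (k ^ ((1 - α) * α) * k ^ (-α * (1 - α))) * (t ^ α * h ^ (1 - α)) := by rw [e, one_mul]
    _ = k ^ ((1 - α) * α) * t ^ α * (k ^ (-α * (1 - α)) * h ^ (1 - α)) := by ring
    _ ≤ _ := key
    _ = _ := by ring

theorem rpow_mul_rpow_le_weighted {α t h : ℝ} (hα : α ∈ Set.Ioo (0 : ℝ) 1) (ht : 0 ≤ t)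
    (hh : 0 ≤ h) : t ^ α * h ^ (1 - α) ≤ α * t + (1 - α) * h := by
  simpa using rpow_mul_rpow_le_tangent hα ht hh one_pos

/-- The marginal value `φ` of including a content type of ratio `t` among the manual creations,
when content there is produced at the level `k t` instead of `a`. -/
noncomputable def inclusionGain (α a k t : ℝ) : ℝ :=
  α * k ^ (1 - α) * t + (1 - α) * k ^ (-α) * a - a ^ (1 - α) * t ^ α

theorem inclusionGain_nonneg {α a k t : ℝ} (hα : α ∈ Set.Ioo (0 : ℝ) 1) (ha : 0 < a) (hk : 0 < k)
    (ht : 0 ≤ t) : 0 ≤ inclusionGain α a k t := by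
  have := rpow_mul_rpow_le_tangent hα ht ha.le hk
  unfold inclusionGain
  linarith [mul_comm (t ^ α) (a ^ (1 - α))]

theorem inclusionGain_eq_zero {α a k t : ℝ} (ha : 0 < a) (hk : 0 < k)
    (h : k * t = a) : inclusionGain α a k t = 0 := by
  subst h
  have ht : 0 < t := by
    by_contra hn
    nlinarith
  unfold inclusionGain
  rw [Real.mul_rpow hk.le ht.le]
  have e1 : k ^ (1 - α) = k ^ (-α) * k := by
    rw [show 1 - α = -α + 1 by ring, Real.rpow_add_one hk.ne']
  have e2 : t ^ (1 - α) * t ^ α = t := by rw [← Real.rpow_add ht]; simp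
  calc _ = α * k ^ (1 - α) * t + (1 - α) * k ^ (-α) * (k * t)
        - k ^ (1 - α) * (t ^ (1 - α) * t ^ α) := by ring
    _ = 0 := by rw [e2, e1]; ring

theorem inclusionGain_mono {α a k t t' : ℝ} (hα : α ∈ Set.Ioo (0 : ℝ) 1) (ha : 0 < a) (hk : 0 < k)
    (h : a ≤ k * t) (htt : t ≤ t') : inclusionGain α a k t ≤ inclusionGain α a k t' := by
  have ht : 0 < t := by
    by_contra hn
    nlinarith
  have ht' : 0 < t' := ht.trans_le htt
  obtain ⟨h0, h1⟩ := hα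
  -- the tangent of `t ↦ t ^ α` at `t`
  have key := rpow_mul_rpow_le_tangent ⟨h0, h1⟩ ht'.le zero_le_one (inv_pos.2 ht)
  rw [Real.one_rpow, mul_one, mul_one, Real.inv_rpow ht.le, Real.inv_rpow ht.le,
    ← Real.rpow_neg ht.le, ← Real.rpow_neg ht.le, neg_neg] at key
  have e1 : t ^ α = t ^ (-(1 - α)) * t := by
    rw [show α = -(1 - α) + 1 by ring, Real.rpow_add_one ht.ne']; ring_nf
  have h2 : t' ^ α - t ^ α ≤ α * t ^ (-(1 - α)) * (t' - t) := by
    rw [mul_sub, mul_assoc α _ t, ← e1]; linarith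
  have h3 : a ^ (1 - α) * t ^ (-(1 - α)) ≤ k ^ (1 - α) := by
    rw [Real.rpow_neg ht.le, ← div_eq_mul_inv, ← Real.div_rpow ha.le ht.le]
    exact Real.rpow_le_rpow (by positivity) ((div_le_iff₀ ht).2 h) (by linarith)
  have h4 : a ^ (1 - α) * (t' ^ α - t ^ α) ≤ α * k ^ (1 - α) * (t' - t) := by
    calc _ ≤ a ^ (1 - α) * (α * t ^ (-(1 - α)) * (t' - t)) := by gcongr
      _ = α * (a ^ (1 - α) * t ^ (-(1 - α))) * (t' - t) := by ring
      _ ≤ _ := by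
        have : 0 ≤ t' - t := by linarith
        gcongr
  unfold inclusionGain
  nlinarith [h4]

/-- Linearization of the quality of a content density `h ≥ a` at the density that equals `k t` for
`t ≥ τ` and `a` for `t < τ`, with the price `inclusionGain α a k τ` charged wherever `h > a`. -/
theorem quality_le_linearization {α a k τ t h : ℝ} (hα : α ∈ Set.Ioo (0 : ℝ) 1) (ha : 0 < a)
    (hk : 0 < k) (hτ : a ≤ k * τ) (ht : 0 < t) (hh : a ≤ h) :
    t ^ α * h ^ (1 - α) ≤ a ^ (1 - α) * t ^ α + (1 - α) * k ^ (-α) * (h - a)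
      + (if τ ≤ t then inclusionGain α a k t - inclusionGain α a k τ else 0)
      + (if a < h then inclusionGain α a k τ else 0) := by
  have hα' := hα
  obtain ⟨h0, h1⟩ := hα'
  have hτ0 : 0 < τ := by
    by_contra hn
    nlinarith
  rcases hh.eq_or_lt with rfl | hlt
  · simp only [sub_self, mul_zero, add_zero, lt_irrefl, if_false]
    split_ifs with hK
    · have := inclusionGain_mono hα ha hk hτ hK
      linarith [mul_comm (t ^ α) (a ^ (1 - α))]
    · linarith [mul_comm (t ^ α) (a ^ (1 - α))]
  · rw [if_pos hlt]
    have hh0 : 0 < h := ha.trans hlt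
    have key : a ≤ k * t → t ^ α * h ^ (1 - α) ≤ a ^ (1 - α) * t ^ α
        + (1 - α) * k ^ (-α) * (h - a) + inclusionGain α a k t := by
      intro _
      have := rpow_mul_rpow_le_tangent hα ht.le hh0.le hk
      unfold inclusionGain
      linarith
    by_cases hK : τ ≤ t
    · rw [if_pos hK]
      have := key (hτ.trans (by gcongr))
      linarith
    · rw [if_neg hK]
      push Not at hK
      by_cases hat : a ≤ k * t
      · have := key hat
        have := inclusionGain_mono hα ha hk hat hK.le
        linarith
      · push Not at hat
        have hz := inclusionGain_nonneg hα ha hk hτ0.le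
        have htan := rpow_mul_rpow_le_tangent hα ht.le hh0.le (div_pos ha ht)
        have hslope : (a / t) ^ (-α) ≤ k ^ (-α) := by
          apply Real.rpow_le_rpow_of_nonpos hk _ (by linarith)
          rw [le_div_iff₀ ht]; exact hat.le
        have e := inclusionGain_eq_zero (α := α) ha (div_pos ha ht) (div_mul_cancel₀ a ht.ne')
        unfold inclusionGain at e
        have : (1 - α) * (a / t) ^ (-α) * (h - a) ≤ (1 - α) * k ^ (-α) * (h - a) := by
          have : 0 ≤ 1 - α := by linarith
          have : 0 ≤ h - a := by linarith
          gcongr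
        linarith

/-- Concavity of the Cobb–Douglas function, for an increment that increases both arguments from
`(P, Q)` to `(P', Q')` with `P' ≤ Q'`: the gain is at least the one computed with the prices
of the diagonal, as the increment leans to the scarce argument. -/
theorem le_rpow_mul_rpow_sub {α P Q P' Q' a ρ δ : ℝ} (hα : α ∈ Set.Ioo (0 : ℝ) 1) (hP : 0 ≤ P)
    (hQ : 0 ≤ Q) (hP' : 0 < P') (hPQ : P' ≤ Q') (ha : 0 ≤ a) (haρ : a ≤ ρ) (hδ : 0 ≤ δ)
    (hdP : ρ * δ ≤ P' - P) (hdQ : Q' - Q = a * δ) :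
    (α * ρ + (1 - α) * a) * δ ≤ P' ^ α * Q' ^ (1 - α) - P ^ α * Q ^ (1 - α) := by
  have hα' := hα
  obtain ⟨h0, h1⟩ := hα'
  have hQ' : 0 < Q' := hP'.trans_le hPQ
  set k := Q' / P' with hk
  have hk1 : 1 ≤ k := (one_le_div hP').2 hPQ
  have hk0 : 0 < k := by linarith
  have htan := rpow_mul_rpow_le_tangent hα hP hQ hk0
  have he := inclusionGain_eq_zero (α := α) hQ' hk0 (div_mul_cancel₀ Q' hP'.ne')
  unfold inclusionGain at he
  have hw := rpow_mul_rpow_le_tangent hα zero_le_one zero_le_one hk0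
  simp only [Real.one_rpow, mul_one] at hw
  have hk2 : 1 ≤ k ^ (1 - α) := Real.one_le_rpow hk1 (by linarith)
  have h3 : α * ρ + (1 - α) * a ≤ α * k ^ (1 - α) * ρ + (1 - α) * k ^ (-α) * a := by
    nlinarith [mul_nonneg (mul_nonneg h0.le (sub_nonneg.2 haρ)) (sub_nonneg.2 hk2),
      mul_nonneg ha (sub_nonneg.2 hw)]
  have h4 : α * k ^ (1 - α) * (ρ * δ) ≤ α * k ^ (1 - α) * (P' - P) := by gcongr
  have h5 := mul_le_mul_of_nonneg_right h3 hδ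
  have h6 : Q = Q' - a * δ := by linarith
  rw [h6] at htan ⊢
  nlinarith [mul_comm (P' ^ α) (Q' ^ (1 - α))]

/-- The inequality that makes `γ ≤ 2α / (α + 1)` the right bound. -/
theorem one_add_lt_rpow_add {α t : ℝ} (hα : α ∈ Set.Ioo (0 : ℝ) 1) (ht : 1 ≤ t) :
    1 + α < t ^ α + 2 * α * t ^ (α - 1) := by
  have hα' := hα
  obtain ⟨h0, h1⟩ := hα'
  have ht0 : 0 < t := by linarith
  have hb := rpow_mul_rpow_le_weighted (α := 1 - α) (h := 1) ⟨by linarith, by linarith⟩ ht0.le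
    zero_le_one
  rw [Real.one_rpow, mul_one] at hb
  have hpos : 0 < t ^ (α - 1) := Real.rpow_pos_of_pos ht0 _
  have e1 : t ^ α = t ^ (α - 1) * t := by
    rw [← Real.rpow_add_one ht0.ne']; ring_nf
  have e2 : t ^ (α - 1) * t ^ (1 - α) = 1 := by rw [← Real.rpow_add ht0]; simp
  have h2 : (1 + α) * t ^ (1 - α) < t + 2 * α := by
    nlinarith [mul_le_mul_of_nonneg_left hb (by linarith : 0 ≤ 1 + α),
      mul_pos (mul_pos h0 h0) ht0, mul_pos h0 (sub_pos.2 h1)]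
  have h3 := mul_lt_mul_of_pos_left h2 hpos
  rw [e1]
  nlinarith

/-- The two first-order conditions for a share `a` of GenAI and a threshold `ρ` are incompatible if
the content below the threshold is under-provided, which is where `hM'` comes from. Here
`t = ρ / a`, `M = a ^ (-α) E[r ^ α | r < ρ]`, and `u` is the quantity of content below `ρ`. -/
theorem firstOrder_incompatible {α γ t M u : ℝ} (hα : α ∈ Set.Ioo (0 : ℝ) 1)
    (hγ : γ ≤ 2 * α / (α + 1)) (ht : 1 ≤ t) (hu : 0 < u) (hu1 : u ≤ 1) (hM : M ≤ t ^ α)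
    (hM' : t ^ (α - 1) ≤ M)
    (h : u * (α * t + (1 - α) - t ^ α)
      ≤ (1 - α) - (1 - α) * M - (1 - γ) * (α * M / u + t ^ α - M)) : False := by
  have hα' := hα
  obtain ⟨h0, h1⟩ := hα'
  have ht0 : 0 < t := by linarith
  have hw := rpow_mul_rpow_le_weighted hα ht0.le zero_le_one
  rw [Real.one_rpow, mul_one, mul_one] at hw
  have hlt := one_add_lt_rpow_add hα ht
  have hM0 : 0 < M := (Real.rpow_pos_of_pos ht0 _).trans_le hM'
  have hγ' : (1 - α) / (1 + α) ≤ 1 - γ := by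
    have : 2 * α / (α + 1) + (1 - α) / (1 + α) = 1 := by field_simp; ring
    linarith
  have hMu : M ≤ M / u := by rw [le_div_iff₀ hu]; nlinarith
  have hX : α * M + t ^ α - M ≤ α * M / u + t ^ α - M := by
    rw [mul_div_assoc]; nlinarith
  have hX0 : 0 ≤ α * M + t ^ α - M := by nlinarith
  have h2 : (1 - α) / (1 + α) * (α * M + t ^ α - M) ≤ (1 - γ) * (α * M / u + t ^ α - M) :=
    mul_le_mul hγ' hX hX0 (le_trans (div_nonneg (by linarith) (by linarith)) hγ')
  have h3 : 0 ≤ u * (α * t + (1 - α) - t ^ α) := mul_nonneg hu.le (by linarith)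
  have h4 : (1 - α) / (1 + α) * (α * M + t ^ α - M) ≤ (1 - α) * (1 - M) := by linarith
  rw [div_mul_eq_mul_div, div_le_iff₀ (by linarith)] at h4
  have h5 : (1 - α) * (α * M + t ^ α - M) ≤ (1 - α) * ((1 - M) * (1 + α)) := by linarith
  have h6 := le_of_mul_le_mul_left h5 (by linarith : 0 < 1 - α)
  nlinarith

/-! ### Truncated moments of the ratio -/

/-- A random variable `r` with mean `1`, values in `[l, u]` with `l > 0`, and no atoms. It is the
ratio `p / g` under the distribution with density `g`. -/
structure IsAtomlessRatio {Ω : Type*} [MeasurableSpace Ω] (ν : Measure Ω) (r : Ω → ℝ) (l u : ℝ) :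
    Prop where
  measurable : Measurable r
  pos : 0 < l
  le : ∀ x, l ≤ r x
  ge : ∀ x, r x ≤ u
  integral_eq_one : ∫ x, r x ∂ν = 1
  atomless : ∀ t, ν {x | r x = t} = 0

/-- The truncated expectation `E[f(r); r < ρ]`. -/
noncomputable def below {Ω : Type*} [MeasurableSpace Ω] (ν : Measure Ω) (r : Ω → ℝ) (f : ℝ → ℝ)
    (ρ : ℝ) : ℝ := ∫ x in {x | r x < ρ}, f (r x) ∂ν

/-- The probability of `r < ρ`. -/
noncomputable abbrev belowMass {Ω : Type*} [MeasurableSpace Ω] (ν : Measure Ω) (r : Ω → ℝ) (ρ : ℝ) :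
    ℝ := below ν r (fun _ => 1) ρ

/-- The truncated mean `E[r; r < ρ]`, the popularity of the types below `ρ`. -/
noncomputable abbrev belowMean {Ω : Type*} [MeasurableSpace Ω] (ν : Measure Ω) (r : Ω → ℝ) (ρ : ℝ) :
    ℝ := below ν r id ρ

/-- The truncated moment `E[r ^ α; r < ρ]`. -/
noncomputable abbrev belowMoment {Ω : Type*} [MeasurableSpace Ω] (ν : Measure Ω) (r : Ω → ℝ)
    (α ρ : ℝ) : ℝ := below ν r (fun t => t ^ α) ρ

theorem compl_setOf_lt_eq {Ω : Type*} (r : Ω → ℝ) (ρ : ℝ) :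
    {x | r x < ρ}ᶜ = {x | ρ ≤ r x} := by
  ext x; simp

namespace IsAtomlessRatio

variable {Ω : Type*} [MeasurableSpace Ω] {ν : Measure Ω} {r : Ω → ℝ} {l u : ℝ}

theorem ratio_pos (h : IsAtomlessRatio ν r l u) (x : Ω) : 0 < r x := h.pos.trans_le (h.le x)

theorem measurableSet_below (h : IsAtomlessRatio ν r l u) (ρ : ℝ) : MeasurableSet {x | r x < ρ} :=
  measurableSet_lt h.measurable measurable_const

theorem integrable_id [IsProbabilityMeasure ν] (h : IsAtomlessRatio ν r l u) :
    Integrable (fun x => id (r x)) ν := by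
  refine Integrable.of_bound h.measurable.aestronglyMeasurable u (.of_forall fun x => ?_)
  rw [id, Real.norm_of_nonneg (h.ratio_pos x).le]
  exact h.ge x

theorem integrable_rpow [IsProbabilityMeasure ν] (h : IsAtomlessRatio ν r l u) {α : ℝ}
    (hα : 0 ≤ α) : Integrable (fun x => r x ^ α) ν := by
  refine Integrable.of_bound (h.measurable.pow_const α).aestronglyMeasurable (u ^ α)
    (.of_forall fun x => ?_)
  rw [Real.norm_of_nonneg (Real.rpow_nonneg (h.ratio_pos x).le α)]
  exact Real.rpow_le_rpow (h.ratio_pos x).le (h.ge x) hα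

theorem le_upper [IsProbabilityMeasure ν] (h : IsAtomlessRatio ν r l u) : l ≤ u := by
  obtain ⟨x⟩ := nonempty_of_isProbabilityMeasure ν
  exact (h.le x).trans (h.ge x)

theorem below_eq_integral_indicator (h : IsAtomlessRatio ν r l u) (f : ℝ → ℝ) (ρ : ℝ) :
    below ν r f ρ = ∫ x, {x | r x < ρ}.indicator (fun x => f (r x)) x ∂ν :=
  (integral_indicator (h.measurableSet_below ρ)).symm

theorem continuous_below (h : IsAtomlessRatio ν r l u) {f : ℝ → ℝ}
    (hf : Integrable (fun x => f (r x)) ν) : Continuous (below ν r f) := by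
  rw [continuous_iff_continuousAt]
  intro ρ
  simp_rw [funext (h.below_eq_integral_indicator f)]
  refine continuousAt_of_dominated (bound := fun x => ‖f (r x)‖)
    (.of_forall fun t => hf.aestronglyMeasurable.indicator (h.measurableSet_below t))
    (.of_forall fun t => .of_forall fun x => norm_indicator_le_norm_self _ _) hf.norm ?_
  have hne : ∀ᵐ x ∂ν, r x ≠ ρ := by
    rw [ae_iff]; simpa using h.atomless ρ
  filter_upwards [hne] with x hx
  rcases hx.lt_or_gt with hlt | hgt
  · refine (continuousAt_const (y := f (r x))).congr ?_
    filter_upwards [lt_mem_nhds hlt] with t ht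
    exact (Set.indicator_of_mem (s := {x | r x < t}) (show r x < t from ht) fun x => f (r x)).symm
  · refine (continuousAt_const (y := (0 : ℝ))).congr ?_
    filter_upwards [gt_mem_nhds hgt] with t ht
    exact (Set.indicator_of_notMem (s := {x | r x < t})
      (not_lt.2 (le_of_lt ht) : ¬ r x < t) fun x => f (r x)).symm

theorem below_lower (h : IsAtomlessRatio ν r l u) (f : ℝ → ℝ) : below ν r f l = 0 := by
  have : {x | r x < l} = ∅ := by
    ext x; simpa using h.le x
  rw [below, this]; simp

theorem below_upper (h : IsAtomlessRatio ν r l u) (f : ℝ → ℝ) :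
    below ν r f u = ∫ x, f (r x) ∂ν := by
  have : {x | r x < u} =ᵐ[ν] Set.univ := by
    rw [ae_eq_univ, compl_setOf_lt_eq]
    refine measure_mono_null (fun x hx => ?_) (h.atomless u)
    exact le_antisymm (h.ge x) hx
  rw [below, setIntegral_congr_set this, setIntegral_univ]

theorem belowMass_upper [IsProbabilityMeasure ν] (h : IsAtomlessRatio ν r l u) :
    belowMass ν r u = 1 := by
  rw [belowMass, h.below_upper]; simp

theorem belowMean_upper (h : IsAtomlessRatio ν r l u) : belowMean ν r u = 1 := by
  rw [belowMean, h.below_upper]; exact h.integral_eq_one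

theorem below_const_mul (f : ℝ → ℝ) (k ρ : ℝ) :
    below ν r (fun t => k * f t) ρ = k * below ν r f ρ := integral_const_mul _ _

theorem integral_compl [IsProbabilityMeasure ν] (h : IsAtomlessRatio ν r l u) {f : ℝ → ℝ}
    (hf : Integrable (fun x => f (r x)) ν) (ρ : ℝ) :
    ∫ x in {x | ρ ≤ r x}, f (r x) ∂ν = ∫ x, f (r x) ∂ν - below ν r f ρ := by
  rw [← compl_setOf_lt_eq, ← integral_add_compl (h.measurableSet_below ρ) hf, below]; ring

theorem below_le_below (h : IsAtomlessRatio ν r l u) {f f' : ℝ → ℝ}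
    (hf : Integrable (fun x => f (r x)) ν) (hf' : Integrable (fun x => f' (r x)) ν) {ρ : ℝ}
    (hle : ∀ t, 0 < t → t < ρ → f t ≤ f' t) : below ν r f ρ ≤ below ν r f' ρ :=
  setIntegral_mono_on hf.integrableOn hf'.integrableOn (h.measurableSet_below ρ)
    fun x hx => hle _ (h.ratio_pos x) hx

theorem below_sub_le_below_sub (h : IsAtomlessRatio ν r l u) {f f' : ℝ → ℝ}
    (hf : Integrable (fun x => f (r x)) ν) (hf' : Integrable (fun x => f' (r x)) ν) {ρ ρ' : ℝ}
    (hρ : ρ' ≤ ρ) (hle : ∀ t, 0 < t → ρ' ≤ t → t < ρ → f t ≤ f' t) :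
    below ν r f ρ - below ν r f ρ' ≤ below ν r f' ρ - below ν r f' ρ' := by
  have hsplit : ∀ {k : ℝ → ℝ}, Integrable (fun x => k (r x)) ν →
      below ν r k ρ - below ν r k ρ' = ∫ x in {x | r x < ρ} \ {x | r x < ρ'}, k (r x) ∂ν :=
    fun hk => (setIntegral_sdiff (h.measurableSet_below ρ') hk.integrableOn
      (fun x hx => lt_of_lt_of_le hx hρ)).symm
  rw [hsplit hf, hsplit hf']
  exact setIntegral_mono_on hf.integrableOn hf'.integrableOn
    ((h.measurableSet_below ρ).diff (h.measurableSet_below ρ'))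
    fun x hx => hle _ (h.ratio_pos x) (not_lt.1 hx.2) hx.1

theorem below_const (k ρ : ℝ) : below ν r (fun _ => k) ρ = k * belowMass ν r ρ := by
  simpa using below_const_mul (ν := ν) (r := r) (fun _ => 1) k ρ

theorem belowMass_nonneg (h : IsAtomlessRatio ν r l u) (ρ : ℝ) : 0 ≤ belowMass ν r ρ :=
  setIntegral_nonneg (h.measurableSet_below ρ) fun _ _ => zero_le_one

theorem belowMoment_nonneg (h : IsAtomlessRatio ν r l u) (α ρ : ℝ) : 0 ≤ belowMoment ν r α ρ :=
  setIntegral_nonneg (h.measurableSet_below ρ) fun x _ => Real.rpow_nonneg (h.ratio_pos x).le α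

theorem belowMass_eq_measureReal (ν : Measure Ω) (r : Ω → ℝ) (ρ : ℝ) :
    belowMass ν r ρ = ν.real {x | r x < ρ} := by
  simp [below]

variable [IsProbabilityMeasure ν]

theorem integrable_one (_h : IsAtomlessRatio ν r l u) (k : ℝ) :
    Integrable (fun x => (fun _ : ℝ => k) (r x)) ν := integrable_const k

theorem continuous_belowMass (h : IsAtomlessRatio ν r l u) : Continuous (belowMass ν r) :=
  h.continuous_below (h.integrable_one 1)

theorem continuous_belowMean (h : IsAtomlessRatio ν r l u) : Continuous (belowMean ν r) :=
  h.continuous_below h.integrable_id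

theorem continuous_belowMoment (h : IsAtomlessRatio ν r l u) {α : ℝ} (hα : 0 ≤ α) :
    Continuous (belowMoment ν r α) :=
  h.continuous_below (h.integrable_rpow hα)

theorem belowMass_mono (h : IsAtomlessRatio ν r l u) {ρ ρ' : ℝ} (hρ : ρ' ≤ ρ) :
    belowMass ν r ρ' ≤ belowMass ν r ρ := by
  have := h.below_sub_le_below_sub (h.integrable_one 0) (h.integrable_one 1) hρ
    (fun _ _ _ _ => zero_le_one)
  rw [below_const, below_const] at this
  linarith

theorem belowMass_le_one (ν : Measure Ω) [IsProbabilityMeasure ν] (r : Ω → ℝ) (ρ : ℝ) :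
    belowMass ν r ρ ≤ 1 := by
  rw [belowMass_eq_measureReal]; exact measureReal_le_one

theorem belowMean_sub_ge (h : IsAtomlessRatio ν r l u) {ρ ρ' : ℝ} (hρ : ρ' ≤ ρ) :
    ρ' * (belowMass ν r ρ - belowMass ν r ρ') ≤ belowMean ν r ρ - belowMean ν r ρ' := by
  have := h.below_sub_le_below_sub (h.integrable_one ρ') h.integrable_id hρ (fun t _ ht _ => ht)
  rwa [below_const, below_const, ← mul_sub] at this

theorem belowMean_sub_le (h : IsAtomlessRatio ν r l u) {ρ ρ' : ℝ} (hρ : ρ' ≤ ρ) :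
    belowMean ν r ρ - belowMean ν r ρ' ≤ ρ * (belowMass ν r ρ - belowMass ν r ρ') := by
  have := h.below_sub_le_below_sub h.integrable_id (h.integrable_one ρ) hρ (fun t _ _ ht => ht.le)
  rwa [below_const, below_const, ← mul_sub] at this

theorem belowMoment_sub_ge (h : IsAtomlessRatio ν r l u) {α ρ ρ' : ℝ} (hα : 0 ≤ α) (hρ : ρ' ≤ ρ)
    (hρ' : 0 ≤ ρ') : ρ' ^ α * (belowMass ν r ρ - belowMass ν r ρ') ≤
      belowMoment ν r α ρ - belowMoment ν r α ρ' := by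
  have := h.below_sub_le_below_sub (h.integrable_one (ρ' ^ α)) (h.integrable_rpow hα) hρ
    (fun t _ ht _ => Real.rpow_le_rpow hρ' ht hα)
  rwa [below_const, below_const, ← mul_sub] at this

theorem belowMoment_sub_le (h : IsAtomlessRatio ν r l u) {α ρ ρ' : ℝ} (hα : 0 ≤ α) (hρ : ρ' ≤ ρ) :
    belowMoment ν r α ρ - belowMoment ν r α ρ' ≤
      ρ ^ α * (belowMass ν r ρ - belowMass ν r ρ') := by
  have := h.below_sub_le_below_sub (h.integrable_rpow hα) (h.integrable_one (ρ ^ α)) hρ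
    (fun t ht0 _ ht => Real.rpow_le_rpow ht0.le ht.le hα)
  rwa [below_const, below_const, ← mul_sub] at this

theorem belowMean_le_mul (h : IsAtomlessRatio ν r l u) (ρ : ℝ) :
    belowMean ν r ρ ≤ ρ * belowMass ν r ρ := by
  have := h.below_le_below h.integrable_id (h.integrable_one ρ) (ρ := ρ) (fun t _ ht => ht.le)
  rwa [below_const] at this

theorem belowMean_mono (h : IsAtomlessRatio ν r l u) {ρ ρ' : ℝ} (hρ' : 0 ≤ ρ') (hρ : ρ' ≤ ρ) :
    belowMean ν r ρ' ≤ belowMean ν r ρ := by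
  nlinarith [h.belowMean_sub_ge hρ, h.belowMass_mono hρ]

theorem belowMean_le_one (h : IsAtomlessRatio ν r l u) {ρ : ℝ} (hρ : ρ ∈ Set.Icc l u) :
    belowMean ν r ρ ≤ 1 := by
  rw [← h.belowMean_upper]; exact h.belowMean_mono (h.pos.le.trans hρ.1) hρ.2

theorem belowMoment_le_mul (h : IsAtomlessRatio ν r l u) {α : ℝ} (hα : 0 ≤ α) (ρ : ℝ) :
    belowMoment ν r α ρ ≤ ρ ^ α * belowMass ν r ρ := by
  have := h.below_le_below (h.integrable_rpow hα) (h.integrable_one (ρ ^ α)) (ρ := ρ)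
    (fun t ht0 ht => Real.rpow_le_rpow ht0.le ht.le hα)
  rwa [below_const] at this

theorem mul_belowMean_le_belowMoment (h : IsAtomlessRatio ν r l u) {α : ℝ}
    (hα : α ∈ Set.Ioo (0 : ℝ) 1) (ρ : ℝ) :
    ρ ^ (α - 1) * belowMean ν r ρ ≤ belowMoment ν r α ρ := by
  rw [belowMean, ← below_const_mul]
  refine h.below_le_below (h.integrable_id.const_mul _) (h.integrable_rpow hα.1.le) ?_
  intro t ht htρ
  have e : t ^ α = t ^ (α - 1) * t := by rw [← Real.rpow_add_one ht.ne']; ring_nf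
  rw [e]
  exact mul_le_mul_of_nonneg_right
    (Real.rpow_le_rpow_of_nonpos ht htρ.le (by linarith [hα.2])) ht.le

/-- A ratio of mean `1` has mean at most `1` on its lower tails. -/
theorem belowMean_le_belowMass (h : IsAtomlessRatio ν r l u) {ρ : ℝ} (hρ : ρ ∈ Set.Icc l u) :
    belowMean ν r ρ ≤ belowMass ν r ρ := by
  rcases le_total ρ 1 with h1 | h1
  · nlinarith [h.belowMean_le_mul ρ, h.belowMass_nonneg ρ]
  · have := h.belowMean_sub_ge hρ.2
    rw [h.belowMean_upper, h.belowMass_upper] at this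
    nlinarith [belowMass_le_one ν r ρ]

/-- Among the sets of given probability, a lower tail has the smallest moment. -/
theorem belowMoment_le_setIntegral (h : IsAtomlessRatio ν r l u) {α ρ : ℝ} (hα : 0 ≤ α)
    (hρ0 : 0 ≤ ρ) {s : Set Ω} (hs : MeasurableSet s) (hsρ : belowMass ν r ρ = ν.real s) :
    belowMoment ν r α ρ ≤ ∫ x in s, r x ^ α ∂ν := by
  set K := {x | r x < ρ} with hK
  have hKm : MeasurableSet K := h.measurableSet_below ρ
  have hi := h.integrable_rpow hα
  have hi' : Integrable (fun x => r x ^ α - ρ ^ α) ν := hi.sub (integrable_const _)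
  have key : ∫ x in K, (r x ^ α - ρ ^ α) ∂ν ≤ ∫ x in s, (r x ^ α - ρ ^ α) ∂ν := by
    rw [← integral_indicator hKm, ← integral_indicator hs]
    refine integral_mono (hi'.indicator hKm) (hi'.indicator hs) fun x => ?_
    by_cases hxK : x ∈ K
    · have hx : r x ^ α - ρ ^ α ≤ 0 :=
        sub_nonpos.2 (Real.rpow_le_rpow (h.ratio_pos x).le (le_of_lt hxK) hα)
      simp only [Set.indicator, hxK, if_true]
      split_ifs <;> linarith
    · have hρ : ρ ≤ r x := not_lt.1 hxK
      simp only [Set.indicator, hxK, if_false]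
      split_ifs
      · exact sub_nonneg.2 (Real.rpow_le_rpow hρ0 hρ hα)
      · exact le_rfl
  rw [integral_sub hi.integrableOn (integrable_const _), integral_sub hi.integrableOn
    (integrable_const _), setIntegral_const, setIntegral_const, ← hsρ,
    ← belowMass_eq_measureReal] at key
  exact sub_le_sub_iff_right _ |>.1 key

theorem exists_belowMass_eq (h : IsAtomlessRatio ν r l u) {m : ℝ} (h0 : 0 ≤ m) (h1 : m ≤ 1) :
    ∃ ρ ∈ Set.Icc l u, belowMass ν r ρ = m := by
  refine intermediate_value_Icc h.le_upper h.continuous_belowMass.continuousOn ⟨?_, ?_⟩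
  · rwa [belowMass, h.below_lower]
  · rwa [h.belowMass_upper]

/-- The quality `∫ r ^ α q ^ (1 - α)` of a content density `q` that is at least `a` is at most the
quality of the density that equals `k r` for `r ≥ ρ` and `a` for `r < ρ`, if the latter
is above `a` on a set that is no smaller, or if no constraint on this set binds (`k ρ = a`). -/
theorem integral_quality_le (h : IsAtomlessRatio ν r l u) {α a k ρ b : ℝ}
    (hα : α ∈ Set.Ioo (0 : ℝ) 1) (ha : 0 < a) (hk : 0 < k) (hρ : a ≤ k * ρ)
    (hbal : k * (1 - belowMean ν r ρ) + a * belowMass ν r ρ = 1) {q : Ω → ℝ} (hq : Measurable q)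
    (haq : ∀ x, a ≤ q x) (hqb : ∀ x, q x ≤ b) (hq1 : ∫ x, q x ∂ν = 1)
    (hcase : k * ρ = a ∨ ν.real {x | a < q x} ≤ 1 - belowMass ν r ρ) :
    ∫ x, r x ^ α * q x ^ (1 - α) ∂ν
      ≤ k ^ (1 - α) * (1 - belowMean ν r ρ) + a ^ (1 - α) * belowMoment ν r α ρ := by
  have hα0 := hα.1
  have hα1 : 0 ≤ 1 - α := by linarith [hα.2]
  set κ := inclusionGain α a k ρ with hκ
  set K := {x | ρ ≤ r x} with hK
  set B := {x | a < q x} with hB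
  have hKm : MeasurableSet K := measurableSet_le measurable_const h.measurable
  have hBm : MeasurableSet B := measurableSet_lt measurable_const hq
  have hq0 : ∀ x, 0 < q x := fun x => ha.trans_le (haq x)
  have hiq : Integrable q ν := .of_bound hq.aestronglyMeasurable b (.of_forall fun x => by
    rw [Real.norm_of_nonneg (hq0 x).le]; exact hqb x)
  have hir := h.integrable_rpow hα0.le
  have hiC : Integrable (fun x => r x ^ α * q x ^ (1 - α)) ν := by
    refine hir.mul_bdd (c := b ^ (1 - α)) (hq.pow_const _).aestronglyMeasurable
      (.of_forall fun x => ?_)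
    rw [Real.norm_of_nonneg (Real.rpow_nonneg (hq0 x).le _)]
    exact Real.rpow_le_rpow (hq0 x).le (hqb x) hα1
  have hiφ : Integrable (fun x => inclusionGain α a k (r x) - κ) ν :=
    (((h.integrable_id.const_mul _).add (integrable_const _)).sub (hir.const_mul _)).sub
      (integrable_const _)
  have hi1 : Integrable (fun x => a ^ (1 - α) * r x ^ α) ν := hir.const_mul _
  have hi2 : Integrable (fun x => (1 - α) * k ^ (-α) * (q x - a)) ν :=
    (hiq.sub (integrable_const _)).const_mul _
  have hi3 : Integrable (K.indicator fun x => inclusionGain α a k (r x) - κ) ν :=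
    hiφ.indicator hKm
  have hi4 : Integrable (B.indicator fun _ => κ) ν := (integrable_const κ).indicator hBm
  have hle : ∫ x, r x ^ α * q x ^ (1 - α) ∂ν ≤ ∫ x, (a ^ (1 - α) * r x ^ α
      + (1 - α) * k ^ (-α) * (q x - a) + K.indicator (fun x => inclusionGain α a k (r x) - κ) x
      + B.indicator (fun _ => κ) x) ∂ν := by
    refine integral_mono hiC (((hi1.add hi2).add hi3).add hi4) fun x => ?_
    have := quality_le_linearization hα ha hk hρ (h.ratio_pos x) (haq x)
    simpa [Set.indicator, hK, hB] using this
  rw [integral_add (by exact (hi1.add hi2).add hi3) hi4, integral_add (by exact hi1.add hi2) hi3,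
    integral_add hi1 hi2, integral_const_mul, integral_const_mul,
    integral_sub hiq (integrable_const _), hq1, integral_indicator hKm, integral_indicator hBm,
    setIntegral_const] at hle
  have hKint : ∫ x in K, (inclusionGain α a k (r x) - κ) ∂ν
      = α * k ^ (1 - α) * (1 - belowMean ν r ρ)
        + ((1 - α) * k ^ (-α) * a - κ) * (1 - belowMass ν r ρ)
        - a ^ (1 - α) * (∫ x, r x ^ α ∂ν - belowMoment ν r α ρ) := by
    have e1 := h.integral_compl h.integrable_id ρ
    have e2 := h.integral_compl (f := fun _ => (1 - α) * k ^ (-α) * a - κ) (h.integrable_one _) ρ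
    have e3 := h.integral_compl (f := fun t => t ^ α) hir ρ
    simp only [id, h.integral_eq_one] at e1
    rw [below_const] at e2
    simp only [integral_const, probReal_univ, one_smul] at e2
    calc _ = ∫ x in K, (α * k ^ (1 - α) * r x + ((1 - α) * k ^ (-α) * a - κ)
            - a ^ (1 - α) * r x ^ α) ∂ν := by
          congr 1; ext x; unfold inclusionGain; ring
      _ = _ := by
          rw [integral_sub (by
            exact ((h.integrable_id.const_mul _).add (integrable_const _)).integrableOn)
            hi1.integrableOn, integral_add (by exact (h.integrable_id.const_mul _).integrableOn)
            (integrable_const _), integral_const_mul, integral_const_mul, e1, e3]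
          simp only [integral_const, smul_eq_mul] at e2 ⊢
          rw [e2]
          unfold belowMean
          ring
  have hfree : κ * (ν.real B - (1 - belowMass ν r ρ)) ≤ 0 := by
    rcases hcase with hc | hc
    · rw [hκ, inclusionGain_eq_zero ha hk hc, zero_mul]
    · refine mul_nonpos_of_nonneg_of_nonpos (inclusionGain_nonneg hα ha hk ?_) (by linarith)
      by_contra hn
      nlinarith
  have hk1 : k ^ (1 - α) = k ^ (-α) * k := by
    rw [show 1 - α = -α + 1 by ring, Real.rpow_add_one hk.ne']
  simp only [integral_const, probReal_univ, smul_eq_mul] at hle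
  rw [hKint] at hle
  have hfin : (1 - α) * k ^ (-α) * (1 - a) + (1 - α) * k ^ (-α) * a * (1 - belowMass ν r ρ)
      = (1 - α) * (k ^ (1 - α) * (1 - belowMean ν r ρ)) := by
    rw [hk1]
    linear_combination ((α - 1) * k ^ (-α)) * hbal
  linarith

end IsAtomlessRatio

/-! ### Threshold profiles -/

/-- The data of an equilibrium of a threshold scheme. The content density is `k r` (relative
to `g`) for `r ≥ ρ` and `a` for `r < ρ`, where `a` is the share of GenAI; `θ` is the compensated
revenue for `r ≥ ρ`, that is, the profit from GenAI plus `c`. -/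
structure IsThresholdProfile {Ω : Type*} [MeasurableSpace Ω] (ν : Measure Ω) (r : Ω → ℝ)
    (α γ c l u a ρ k θ : ℝ) : Prop where
  mem : ρ ∈ Set.Icc l u
  share_pos : 0 < a
  level_pos : 0 < k
  /-- Manual creation is nonnegative for `r ≥ ρ`. -/
  share_le : a ≤ k * ρ
  /-- The total quantity of content is `1`. -/
  balance : k * (1 - belowMean ν r ρ) + a * belowMass ν r ρ = 1
  /-- The profit from GenAI is `θ - c`. -/
  revenue_eq : θ * belowMass ν r ρ = c + (1 - γ) * a ^ (-α) * belowMoment ν r α ρ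
  /-- Below the threshold GenAI is at least as profitable as manual creation. -/
  feasible : (1 - γ) * a ^ (-α) * ρ ^ α ≤ θ

/-- The platform's profit at a threshold profile. -/
noncomputable def thresholdProfit {Ω : Type*} [MeasurableSpace Ω] (ν : Measure Ω) (r : Ω → ℝ)
    (α c a ρ k θ : ℝ) : ℝ :=
  k ^ (1 - α) * (1 - belowMean ν r ρ) + a ^ (1 - α) * belowMoment ν r α ρ - θ + c * a

/-- The platform's profit at a threshold profile in terms of `P = E[r; r ≥ ρ]`,
`s = ν(r < ρ)` and `R = E[r ^ α; r < ρ]`, with the level `k` and the revenue `θ` eliminated by the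
equations that determine them. -/
noncomputable def reducedProfit (α γ c P s R a : ℝ) : ℝ :=
  P ^ α * (1 - a * s) ^ (1 - α) + a ^ (1 - α) * R - (c + (1 - γ) * a ^ (-α) * R) / s + c * a

theorem nonpos_of_hasDerivAt_of_eventually_le {f : ℝ → ℝ} {x f' : ℝ} (hf : HasDerivAt f f' x)
    (h : ∀ᶠ y in nhdsWithin x (Set.Ioi x), f y ≤ f x) : f' ≤ 0 := by
  have ht := (hasDerivWithinAt_iff_tendsto_slope' (by simp)).1
    (hf.hasDerivWithinAt (s := Set.Ioi x))
  refine le_of_tendsto ht ?_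
  filter_upwards [h, self_mem_nhdsWithin] with y hy hxy
  rw [slope_def_field]
  exact div_nonpos_of_nonpos_of_nonneg (by linarith) (sub_nonneg.2 (le_of_lt hxy))

/-- The first-order condition in the share of GenAI, at a share that maximizes the profit against
all slightly larger ones, while the types below the threshold are under-provided. -/
theorem le_of_eventually_reducedProfit_le {α γ c P s R a : ℝ} (hα : α ∈ Set.Ioo (0 : ℝ) 1)
    (hP : 0 ≤ P) (hs : 0 < s) (ha : 0 < a) (hPQ : P ≤ 1 - a * s)
    (hQ : 0 < 1 - a * s)
    (h : ∀ᶠ b in nhdsWithin a (Set.Ioi a),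
      reducedProfit α γ c P s R b ≤ reducedProfit α γ c P s R a) :
    c ≤ (1 - α) * s - (1 - α) * (a ^ (-α) * R) - α * (1 - γ) * (a ^ (-α) * R) / (a * s) := by
  obtain ⟨h0, h1⟩ := hα
  have d1 : HasDerivAt (fun b => P ^ α * (1 - b * s) ^ (1 - α))
      (P ^ α * (-(1 * s) * (1 - α) * (1 - a * s) ^ (1 - α - 1))) a :=
    ((((hasDerivAt_id a).mul_const s).const_sub 1).rpow_const (Or.inl hQ.ne')).const_mul _
  have d2 : HasDerivAt (fun b : ℝ => b ^ (1 - α) * R) ((1 - α) * a ^ (1 - α - 1) * R) a :=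
    (Real.hasDerivAt_rpow_const (Or.inl ha.ne')).mul_const R
  have d3 : HasDerivAt (fun b : ℝ => (c + (1 - γ) * b ^ (-α) * R) / s)
      ((1 - γ) * (-α * a ^ (-α - 1)) * R / s) a :=
    ((((Real.hasDerivAt_rpow_const (Or.inl ha.ne')).const_mul _).mul_const R).const_add
      c).div_const s
  have d4 : HasDerivAt (fun b : ℝ => c * b) (c * 1) a := (hasDerivAt_id a).const_mul c
  have key := nonpos_of_hasDerivAt_of_eventually_le (((d1.add d2).sub d3).add d4) h
  have hmarg : P ^ α * (1 - a * s) ^ (1 - α - 1) ≤ 1 := by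
    rw [show 1 - α - 1 = -α by ring, Real.rpow_neg hQ.le, ← div_eq_mul_inv]
    exact div_le_one_of_le₀ (Real.rpow_le_rpow hP hPQ h0.le) (Real.rpow_nonneg hQ.le _)
  have e1 : a ^ (1 - α - 1) = a ^ (-α) := by congr 1; ring
  have e2 : (1 - γ) * (-α * a ^ (-α - 1)) * R / s = -(α * (1 - γ) * (a ^ (-α) * R) / (a * s)) := by
    rw [Real.rpow_sub_one ha.ne']; field_simp
  rw [e1, e2] at key
  have h2 : s * (1 - α) * (P ^ α * (1 - a * s) ^ (1 - α - 1)) ≤ s * (1 - α) * 1 := by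
    have : 0 ≤ 1 - α := by linarith
    gcongr
  nlinarith

/-- The slack of the feasibility condition of a threshold profile, cleared of denominators. -/
theorem threshold_slack_eq {Ω : Type*} [MeasurableSpace Ω] {ν : Measure Ω} {r : Ω → ℝ}
    {α γ c a ρ θ : ℝ} (ha : 0 < a)
    (hθ : θ * belowMass ν r ρ = c + (1 - γ) * a ^ (-α) * belowMoment ν r α ρ) :
    (θ - (1 - γ) * a ^ (-α) * ρ ^ α) * (belowMass ν r ρ * a ^ α)
      = c * a ^ α + (1 - γ) * (belowMoment ν r α ρ - ρ ^ α * belowMass ν r ρ) := by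
  have e : a ^ (-α) * a ^ α = 1 := by rw [← Real.rpow_add ha]; simp
  linear_combination a ^ α * hθ + (1 - γ) * (belowMoment ν r α ρ - ρ ^ α * belowMass ν r ρ) * e

theorem threshold_feasible_iff {Ω : Type*} [MeasurableSpace Ω] {ν : Measure Ω} {r : Ω → ℝ}
    {α γ c a ρ θ : ℝ} (ha : 0 < a) (hs : 0 < belowMass ν r ρ)
    (hθ : θ * belowMass ν r ρ = c + (1 - γ) * a ^ (-α) * belowMoment ν r α ρ) :
    (1 - γ) * a ^ (-α) * ρ ^ α ≤ θ ↔
      0 ≤ c * a ^ α + (1 - γ) * (belowMoment ν r α ρ - ρ ^ α * belowMass ν r ρ) := by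
  rw [← threshold_slack_eq ha hθ, mul_nonneg_iff_of_pos_right
    (mul_pos hs (Real.rpow_pos_of_pos ha α)), sub_nonneg]

namespace IsAtomlessRatio

variable {Ω : Type*} [MeasurableSpace Ω] {ν : Measure Ω} [IsProbabilityMeasure ν] {r : Ω → ℝ}
  {l u : ℝ}

/-- The quality of a threshold profile is at most that of the popularity distribution, which
is `1`. -/
theorem quality_le_one (h : IsAtomlessRatio ν r l u) {α a ρ : ℝ} (hα : α ∈ Set.Ioo (0 : ℝ) 1)
    (ha : 0 < a) (ha1 : a ≤ 1) (hρ : ρ ∈ Set.Icc l u) :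
    (1 - belowMean ν r ρ) ^ α * (1 - a * belowMass ν r ρ) ^ (1 - α)
      + a ^ (1 - α) * belowMoment ν r α ρ ≤ 1 := by
  have hs := belowMass_le_one ν r ρ
  have hs0 := belowMass_nonneg h ρ
  have h1 := rpow_mul_rpow_le_weighted hα (sub_nonneg.2 (h.belowMean_le_one hρ))
    (by nlinarith : 0 ≤ 1 - a * belowMass ν r ρ)
  have h2 : below ν r (fun t => a ^ (1 - α) * t ^ α) ρ
      ≤ below ν r (fun t => α * id t + (1 - α) * a) ρ :=
    h.below_le_below ((h.integrable_rpow hα.1.le).const_mul _)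
      ((h.integrable_id.const_mul _).add (integrable_const _)) fun t ht _ => by
        have := rpow_mul_rpow_le_weighted hα ht.le ha.le
        simpa [mul_comm] using this
  rw [below_const_mul] at h2
  have h3 : below ν r (fun t => α * id t + (1 - α) * a) ρ
      = α * belowMean ν r ρ + (1 - α) * a * belowMass ν r ρ := by
    rw [← below_const, ← below_const_mul]
    exact integral_add (h.integrable_id.const_mul _).integrableOn (integrable_const _)
  rw [h3] at h2
  linarith

/-- The numerator of the feasibility condition decreases in the threshold. -/
theorem slack_antitone (h : IsAtomlessRatio ν r l u) {α ρ ρ' : ℝ} (hα : 0 ≤ α) (hρ' : 0 ≤ ρ')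
    (hρ : ρ' ≤ ρ) : belowMoment ν r α ρ - ρ ^ α * belowMass ν r ρ
      ≤ belowMoment ν r α ρ' - ρ' ^ α * belowMass ν r ρ' := by
  have h1 := h.belowMoment_sub_le hα hρ
  have h2 := mul_le_mul_of_nonneg_right (Real.rpow_le_rpow hρ' hρ hα) (belowMass_nonneg h ρ')
  linarith

/-- The first-order condition in the threshold: at a threshold that maximizes the profit
against all slightly smaller ones, while the types below it are under-provided. -/
theorem le_of_eventually_threshold_le (h : IsAtomlessRatio ν r l u) {α γ c a ρ : ℝ}
    (hα : α ∈ Set.Ioo (0 : ℝ) 1) (hγ : γ ≤ 1) (ha : 0 < a) (hρ : ρ ∈ Set.Icc l u)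
    (haρ : a < ρ) (hs : 0 < belowMass ν r ρ) (hL : a * belowMass ν r ρ < belowMean ν r ρ)
    (hstrict : ∀ t < ρ, belowMass ν r t < belowMass ν r ρ)
    (hmax : ∀ᶠ t in nhdsWithin ρ (Set.Iio ρ),
      reducedProfit α γ c (1 - belowMean ν r t) (belowMass ν r t) (belowMoment ν r α t) a ≤
      reducedProfit α γ c (1 - belowMean ν r ρ) (belowMass ν r ρ) (belowMoment ν r α ρ) a) :
    (α * ρ + (1 - α) * a - a ^ (1 - α) * ρ ^ α) * belowMass ν r ρ ≤
      (c + (1 - γ) * a ^ (-α) * belowMoment ν r α ρ) / belowMass ν r ρ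
        - (1 - γ) * a ^ (-α) * ρ ^ α := by
  have cs := h.continuous_belowMass
  have cT := h.continuous_belowMean
  have crp : Continuous fun t : ℝ => t ^ α := Real.continuous_rpow_const hα.1.le
  set s := belowMass ν r ρ with hs_def
  set θ := (c + (1 - γ) * a ^ (-α) * belowMoment ν r α ρ) / s with hθ
  have hθs : θ * s = c + (1 - γ) * a ^ (-α) * belowMoment ν r α ρ := div_mul_cancel₀ _ hs.ne'
  have hev : ∀ᶠ t in nhdsWithin ρ (Set.Iio ρ),
      (α * t + (1 - α) * a - a ^ (1 - α) * ρ ^ α) * belowMass ν r t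
        ≤ θ - (1 - γ) * a ^ (-α) * t ^ α := by
    have n1 : ∀ᶠ t in nhdsWithin ρ (Set.Iio ρ), a < t :=
      nhdsWithin_le_nhds (lt_mem_nhds haρ)
    have n2 : ∀ᶠ t in nhdsWithin ρ (Set.Iio ρ), 0 < belowMass ν r t :=
      nhdsWithin_le_nhds (cs.continuousAt.eventually (lt_mem_nhds hs))
    have n3 : ∀ᶠ t in nhdsWithin ρ (Set.Iio ρ), 0 < belowMean ν r t - a * belowMass ν r t :=
      nhdsWithin_le_nhds ((cT.sub (continuous_const.mul cs)).continuousAt.eventually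
        (lt_mem_nhds (sub_pos.2 hL)))
    filter_upwards [hmax, n1, n2, n3, self_mem_nhdsWithin] with t hm hat hst hLt htρ
    have htρ' : t < ρ := htρ
    have hδ := sub_pos.2 (hstrict t htρ')
    have ht0 : 0 < t := ha.trans hat
    have hT := h.belowMean_sub_ge htρ'.le
    have hR := h.belowMoment_sub_le hα.1.le htρ'.le
    have hR' := h.belowMoment_sub_ge hα.1.le htρ'.le ht0.le
    rw [← hs_def] at hT hR hR'
    have hT1 := h.belowMean_le_one hρ
    have hs1 := belowMass_le_one ν r ρ
    have hgain := le_rpow_mul_rpow_sub (α := α) (P := 1 - belowMean ν r ρ) (Q := 1 - a * s)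
      (P' := 1 - belowMean ν r t) (Q' := 1 - a * belowMass ν r t) (a := a) (ρ := t)
      (δ := s - belowMass ν r t) hα (by linarith) (by nlinarith) (by nlinarith) (by linarith)
      ha.le hat.le hδ.le (by linarith) (by ring)
    have hm1 : a ^ (1 - α) * (belowMoment ν r α ρ - belowMoment ν r α t)
        ≤ a ^ (1 - α) * (ρ ^ α * (s - belowMass ν r t)) := by gcongr
    have hκ : 0 ≤ (1 - γ) * a ^ (-α) :=
      mul_nonneg (sub_nonneg.2 hγ) (Real.rpow_nonneg ha.le _)
    have hm2 := mul_le_mul_of_nonneg_left hR' hκ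
    unfold reducedProfit at hm
    rw [← hθ] at hm
    set θ' := (c + (1 - γ) * a ^ (-α) * belowMoment ν r α t) / belowMass ν r t with hθ'
    have hθs' : θ' * belowMass ν r t = c + (1 - γ) * a ^ (-α) * belowMoment ν r α t :=
      div_mul_cancel₀ _ hst.ne'
    have hX : (α * t + (1 - α) * a - a ^ (1 - α) * ρ ^ α) * (s - belowMass ν r t) ≤ θ' - θ := by
      linarith
    have hX2 := mul_le_mul_of_nonneg_right hX hst.le
    have hX3 : (θ' - θ) * belowMass ν r t
        ≤ (θ - (1 - γ) * a ^ (-α) * t ^ α) * (s - belowMass ν r t) := by linarith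
    refine le_of_mul_le_mul_right ?_ hδ
    linarith
  refine le_of_tendsto_of_tendsto (b := nhdsWithin ρ (Set.Iio ρ)) ?_ ?_ hev
  · have : Continuous fun t => (α * t + (1 - α) * a - a ^ (1 - α) * ρ ^ α) * belowMass ν r t := by
      fun_prop
    exact (this.tendsto ρ).mono_left nhdsWithin_le_nhds
  · have : Continuous fun t : ℝ => θ - (1 - γ) * a ^ (-α) * t ^ α := by fun_prop
    exact (this.tendsto ρ).mono_left nhdsWithin_le_nhds

/-- The pairs `(a, ρ)` of a share `a ≥ a₀` of GenAI and a feasible threshold `ρ` with at least the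
mass `δ` below it, such that the quantity of content below the threshold is at most its
popularity. -/
def underProvided (ν : Measure Ω) (r : Ω → ℝ) (α γ c l u a₀ δ : ℝ) : Set (ℝ × ℝ) :=
  (Set.Icc a₀ 1 ×ˢ Set.Icc l u) ∩ {z | δ ≤ belowMass ν r z.2 ∧
    0 ≤ c * z.1 ^ α + (1 - γ) * (belowMoment ν r α z.2 - z.2 ^ α * belowMass ν r z.2) ∧
    z.1 * belowMass ν r z.2 ≤ belowMean ν r z.2}

theorem isCompact_underProvided (h : IsAtomlessRatio ν r l u) {α γ c a₀ δ : ℝ} (hα : 0 ≤ α) :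
    IsCompact (underProvided ν r α γ c l u a₀ δ) := by
  have cs := h.continuous_belowMass
  have cT := h.continuous_belowMean
  have cR := h.continuous_belowMoment hα
  have crp : Continuous fun t : ℝ => t ^ α := Real.continuous_rpow_const hα
  refine (isCompact_Icc.prod isCompact_Icc).inter_right ?_
  have k1 : IsClosed {z : ℝ × ℝ | δ ≤ belowMass ν r z.2} :=
    isClosed_le continuous_const (cs.comp continuous_snd)
  have k2 : IsClosed {z : ℝ × ℝ | 0 ≤ c * z.1 ^ α
      + (1 - γ) * (belowMoment ν r α z.2 - z.2 ^ α * belowMass ν r z.2)} :=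
    isClosed_le continuous_const ((continuous_const.mul (crp.comp continuous_fst)).add
      (continuous_const.mul ((cR.comp continuous_snd).sub
        ((crp.comp continuous_snd).mul (cs.comp continuous_snd)))))
  have k3 : IsClosed {z : ℝ × ℝ | z.1 * belowMass ν r z.2 ≤ belowMean ν r z.2} :=
    isClosed_le (continuous_fst.mul (cs.comp continuous_snd)) (cT.comp continuous_snd)
  exact k1.inter (k2.inter k3)

/-- A maximizer of the profit on `underProvided` is on the boundary where the quantity of content
below the threshold equals its popularity: raising the share of GenAI and lowering the threshold
both stay inside the domain, and the first-order conditions for these two variations are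
incompatible elsewhere. -/
theorem eq_of_isMaxOn (h : IsAtomlessRatio ν r l u) {α γ c a₀ δ : ℝ} (hα : α ∈ Set.Ioo (0 : ℝ) 1)
    (hγ : γ ≤ 2 * α / (α + 1)) (hc : 0 < c) (ha₀ : 0 < a₀) (hδ : 0 < δ) {z : ℝ × ℝ}
    (hz : z ∈ underProvided ν r α γ c l u a₀ δ) (hzδ : δ < belowMass ν r z.2)
    (hmax : ∀ y ∈ underProvided ν r α γ c l u a₀ δ,
      reducedProfit α γ c (1 - belowMean ν r y.2) (belowMass ν r y.2) (belowMoment ν r α y.2) y.1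
      ≤ reducedProfit α γ c (1 - belowMean ν r z.2) (belowMass ν r z.2) (belowMoment ν r α z.2)
        z.1) :
    belowMean ν r z.2 = z.1 * belowMass ν r z.2 := by
  obtain ⟨a, ρ₀⟩ := z
  obtain ⟨⟨⟨haa, ha1⟩, hρ₀⟩, -, hslack, hL⟩ := hz
  simp only at haa ha1 hρ₀ hzδ hslack hL hmax ⊢
  have hα' := hα
  obtain ⟨h0, h1⟩ := hα'
  have hγ1 : γ < 1 := hγ.trans_lt ((div_lt_one (by linarith)).2 (by linarith))
  by_contra hne
  have hL' : a * belowMass ν r ρ₀ < belowMean ν r ρ₀ := lt_of_le_of_ne hL (Ne.symm hne)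
  have ha : 0 < a := ha₀.trans_le haa
  have cs := h.continuous_belowMass
  have cT := h.continuous_belowMean
  -- the distribution of `r` may have gaps; `ρ` is the smallest threshold equivalent to `ρ₀`
  obtain ⟨ρ, ⟨⟨hlρ, hρρ₀⟩, hsρ⟩, hleast⟩ : ∃ ρ, IsLeast
      (Set.Icc l ρ₀ ∩ {t | belowMass ν r t = belowMass ν r ρ₀}) ρ :=
    (isCompact_Icc.inter_right (isClosed_eq cs continuous_const)).exists_isLeast
      ⟨ρ₀, ⟨hρ₀.1, le_rfl⟩, rfl⟩
  have hsρ : belowMass ν r ρ = belowMass ν r ρ₀ := hsρ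
  have hρ0 : 0 < ρ := h.pos.trans_le hlρ
  have hTρ : belowMean ν r ρ = belowMean ν r ρ₀ := by
    have e1 := h.belowMean_sub_le hρρ₀
    have e2 := h.belowMean_sub_ge hρρ₀
    rw [hsρ, sub_self, mul_zero] at e1 e2
    linarith
  have hRρ : belowMoment ν r α ρ = belowMoment ν r α ρ₀ := by
    have e1 := h.belowMoment_sub_le h0.le hρρ₀
    have e2 := h.belowMoment_sub_ge h0.le hρρ₀ hρ0.le
    rw [hsρ, sub_self, mul_zero] at e1 e2
    linarith
  have hslackρ := h.slack_antitone h0.le hρ0.le hρρ₀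
  rw [← hTρ, ← hsρ, ← hRρ] at hmax
  rw [← hTρ, ← hsρ] at hL'
  rw [← hsρ] at hzδ
  have hρ : ρ ∈ Set.Icc l u := ⟨hlρ, hρρ₀.trans hρ₀.2⟩
  have hs : 0 < belowMass ν r ρ := hδ.trans hzδ
  have hs1 := belowMass_le_one ν r ρ
  have hstrict : ∀ t < ρ, belowMass ν r t < belowMass ν r ρ := by
    intro t ht
    refine lt_of_le_of_ne (h.belowMass_mono ht.le) fun heq => ?_
    rcases le_total l t with hlt | hlt
    · exact absurd (hleast ⟨⟨hlt, ht.le.trans hρρ₀⟩, heq.trans hsρ⟩) (not_le.2 ht)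
    · have := h.belowMass_mono hlt
      rw [belowMass, belowMass, h.below_lower] at this
      linarith [heq]
  have haρ : a < ρ := by nlinarith [h.belowMean_le_mul ρ]
  have ha1' : a < 1 := by nlinarith [h.belowMean_le_belowMass hρ]
  have hQ : 0 < 1 - a * belowMass ν r ρ := by nlinarith
  have hR0 := belowMoment_nonneg h α ρ
  have hslack' : ∀ b, a ≤ b → 0 ≤ c * b ^ α
      + (1 - γ) * (belowMoment ν r α ρ - ρ ^ α * belowMass ν r ρ) := by
    intro b hb
    have := mul_le_mul_of_nonneg_left (Real.rpow_le_rpow ha.le hb h0.le) hc.le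
    have := mul_le_mul_of_nonneg_left hslackρ (by linarith : 0 ≤ 1 - γ)
    linarith
  have hfoc1 := le_of_eventually_reducedProfit_le (α := α) (γ := γ) (c := c)
    (P := 1 - belowMean ν r ρ) (R := belowMoment ν r α ρ) hα
    (sub_nonneg.2 (h.belowMean_le_one hρ)) hs ha (by linarith) hQ (by
      have n1 : ∀ᶠ b in nhdsWithin a (Set.Ioi a), b < 1 := nhdsWithin_le_nhds (gt_mem_nhds ha1')
      have n2 : ∀ᶠ b in nhdsWithin a (Set.Ioi a),
          0 < belowMean ν r ρ - b * belowMass ν r ρ := by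
        have : Continuous fun b => belowMean ν r ρ - b * belowMass ν r ρ := by fun_prop
        exact nhdsWithin_le_nhds (this.continuousAt.eventually (lt_mem_nhds (sub_pos.2 hL')))
      filter_upwards [n1, n2, self_mem_nhdsWithin] with b hb1 hbL hab
      have hab' : a ≤ b := le_of_lt hab
      exact hmax (b, ρ) ⟨⟨⟨haa.trans hab', hb1.le⟩, hρ⟩, hzδ.le, hslack' b hab',
        by simpa using hbL.le⟩)
  have hfoc2 := h.le_of_eventually_threshold_le hα hγ1.le ha hρ haρ hs hL' hstrict (c := c) (by
      have hlρ' : l < ρ := by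
        refine lt_of_le_of_ne hlρ fun heq => ?_
        rw [← heq, belowMass, h.below_lower] at hs
        exact lt_irrefl _ hs
      have n1 : ∀ᶠ t in nhdsWithin ρ (Set.Iio ρ), l < t := nhdsWithin_le_nhds (lt_mem_nhds hlρ')
      have n2 : ∀ᶠ t in nhdsWithin ρ (Set.Iio ρ), δ < belowMass ν r t :=
        nhdsWithin_le_nhds (cs.continuousAt.eventually (lt_mem_nhds hzδ))
      have n3 : ∀ᶠ t in nhdsWithin ρ (Set.Iio ρ), 0 < belowMean ν r t - a * belowMass ν r t :=
        nhdsWithin_le_nhds ((cT.sub (continuous_const.mul cs)).continuousAt.eventually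
          (lt_mem_nhds (sub_pos.2 hL')))
      filter_upwards [n1, n2, n3, self_mem_nhdsWithin] with t hlt hδt hLt htρ
      have htρ' : t ≤ ρ := le_of_lt htρ
      refine hmax (a, t) ⟨⟨⟨haa, ha1⟩, hlt.le, htρ'.trans hρ.2⟩, hδt.le, ?_, by simpa using hLt.le⟩
      have e1 := h.slack_antitone h0.le (h.pos.trans hlt).le htρ'
      have e2 := mul_le_mul_of_nonneg_left e1 (by linarith : 0 ≤ 1 - γ)
      have e3 := hslack' a le_rfl
      simp only
      linarith)
  set s := belowMass ν r ρ with hs_def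
  set R := belowMoment ν r α ρ with hR_def
  have ht : (ρ / a) ^ α = a ^ (-α) * ρ ^ α := by
    rw [Real.div_rpow hρ0.le ha.le, Real.rpow_neg ha.le, div_eq_inv_mul]
  have hκ : 0 < a ^ (-α) := Real.rpow_pos_of_pos ha _
  refine firstOrder_incompatible (t := ρ / a) (M := a ^ (-α) * R / s) (u := a * s) hα hγ
    ((one_le_div ha).2 haρ.le) (mul_pos ha hs) (by nlinarith) ?_ ?_ ?_
  · rw [ht, div_le_iff₀ hs, mul_assoc]
    have := h.belowMoment_le_mul h0.le ρ
    gcongr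
  · have e1 := h.mul_belowMean_le_belowMoment hα ρ
    have e2 : ρ ^ (α - 1) * (a * s) ≤ R := le_trans (by gcongr) e1
    have e3 : (ρ / a) ^ (α - 1) = a ^ (-α) * (ρ ^ (α - 1) * a) := by
      rw [Real.div_rpow hρ0.le ha.le, div_eq_mul_inv, ← Real.rpow_neg ha.le,
        show -(α - 1) = -α + 1 by ring, Real.rpow_add_one ha.ne']
      ring
    rw [e3, le_div_iff₀ hs]
    calc _ = a ^ (-α) * (ρ ^ (α - 1) * (a * s)) := by ring
      _ ≤ _ := by gcongr
  · have ea : a ^ (1 - α) = a * a ^ (-α) := by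
      rw [show 1 - α = -α + 1 by ring, Real.rpow_add_one ha.ne', mul_comm]
    have l1 : a * s * (α * (ρ / a) + (1 - α) - (ρ / a) ^ α)
        = (α * ρ + (1 - α) * a - a ^ (1 - α) * ρ ^ α) * s := by
      rw [ht, ea]; field_simp
    have l2 : c / s ≤ (1 - α) - (1 - α) * (a ^ (-α) * R / s)
        - (1 - γ) * (α * (a ^ (-α) * R / s) / (a * s)) := by
      rw [div_le_iff₀ hs]
      refine hfoc1.trans (le_of_eq ?_)
      field_simp
    have l3 : (c + (1 - γ) * a ^ (-α) * R) / s = c / s + (1 - γ) * (a ^ (-α) * R / s) := by ring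
    rw [l1, ht]
    linarith

/-- If a threshold profile provides the types above its threshold more than in proportion to
their popularity, then a profile with `k = 1` does no worse. This is where the bound on `γ`
enters. -/
theorem exists_profile_level_one (h : IsAtomlessRatio ν r l u) {α γ c a ρ k θ : ℝ}
    (hα : α ∈ Set.Ioo (0 : ℝ) 1) (hγ : γ ≤ 2 * α / (α + 1)) (hc : 0 < c)
    (hprof : IsThresholdProfile ν r α γ c l u a ρ k θ) (hk : 1 ≤ k)
    (hP : 0 < 1 - belowMean ν r ρ) :
    ∃ a' ρ' θ', IsThresholdProfile ν r α γ c l u a' ρ' 1 θ' ∧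
      thresholdProfit ν r α c a ρ k θ ≤ thresholdProfit ν r α c a' ρ' 1 θ' := by
  obtain ⟨hρ, ha, hk0, haρ, hbal, hθ, hfeas⟩ := hprof
  have hα' := hα
  obtain ⟨h0, h1⟩ := hα'
  have hγ1 : γ < 1 := hγ.trans_lt ((div_lt_one (by linarith)).2 (by linarith))
  have hθpos : ∀ {b t : ℝ}, 0 < b → 0 < c + (1 - γ) * b ^ (-α) * belowMoment ν r α t := by
    intro b t hb
    have := mul_nonneg (mul_nonneg (by linarith : 0 ≤ 1 - γ) (Real.rpow_nonneg hb.le (-α)))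
      (belowMoment_nonneg h α t)
    linarith
  have hs0 := belowMass_nonneg h ρ
  have hs : 0 < belowMass ν r ρ := by
    refine lt_of_le_of_ne hs0 fun heq => ?_
    have := hθpos (t := ρ) ha
    rw [← hθ, ← heq, mul_zero] at this
    exact lt_irrefl _ this
  have ha1 : a ≤ 1 := by
    have e1 := h.belowMean_sub_ge hρ.2
    rw [h.belowMean_upper, h.belowMass_upper] at e1
    nlinarith [belowMass_le_one ν r ρ]
  set F : ℝ × ℝ → ℝ := fun y => reducedProfit α γ c (1 - belowMean ν r y.2) (belowMass ν r y.2)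
    (belowMoment ν r α y.2) y.1 with hF
  -- the cost `c / s` bounds `s = ν(r < ρ)` away from `0` where the profit is at least `F (a, ρ)`
  have hFle : ∀ y : ℝ × ℝ, 0 < y.1 → y.1 ≤ 1 → y.2 ∈ Set.Icc l u → 0 < belowMass ν r y.2 →
      F y ≤ 1 + c - c / belowMass ν r y.2 := by
    intro y hy0 hy1 hy hsy
    have e1 := h.quality_le_one hα hy0 hy1 hy
    have e2 : 0 ≤ (1 - γ) * y.1 ^ (-α) * belowMoment ν r α y.2 / belowMass ν r y.2 :=
      div_nonneg (mul_nonneg (mul_nonneg (by linarith) (Real.rpow_nonneg hy0.le _))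
        (belowMoment_nonneg h α y.2)) hsy.le
    have e3 := mul_le_mul_of_nonneg_left hy1 hc.le
    simp only [hF, reducedProfit, add_div]
    linarith
  set B := 1 + c - F (a, ρ) with hB
  have hBs : c / belowMass ν r ρ ≤ B := by
    have := hFle (a, ρ) ha ha1 hρ hs
    simp only at this
    linarith
  have hB0 : 0 < B := lt_of_lt_of_le (div_pos hc hs) hBs
  have hδ : 0 < c / (2 * B) := by positivity
  have hδlt : ∀ {t}, 0 < t → c / t ≤ B → c / (2 * B) < t := by
    intro t ht htB
    rw [div_le_iff₀ ht] at htB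
    rw [div_lt_iff₀ (by positivity)]
    nlinarith
  have hmem : (a, ρ) ∈ underProvided ν r α γ c l u a (c / (2 * B)) :=
    ⟨⟨⟨le_rfl, ha1⟩, hρ⟩, (hδlt hs hBs).le, (threshold_feasible_iff ha hs hθ).1 hfeas, by
      simp only; nlinarith⟩
  have hpos : ∀ y ∈ underProvided ν r α γ c l u a (c / (2 * B)),
      0 < y.1 ∧ y.1 ≤ 1 ∧ y.2 ∈ Set.Icc l u ∧ 0 < belowMass ν r y.2 := fun y hy =>
    ⟨ha.trans_le hy.1.1.1, hy.1.1.2, hy.1.2, hδ.trans_le hy.2.1⟩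
  have hcont : ContinuousOn F (underProvided ν r α γ c l u a (c / (2 * B))) := by
    intro y hy
    obtain ⟨hy0, -, -, hys⟩ := hpos y hy
    have cs : Continuous fun z : ℝ × ℝ => belowMass ν r z.2 :=
      h.continuous_belowMass.comp continuous_snd
    have cT : Continuous fun z : ℝ × ℝ => belowMean ν r z.2 :=
      h.continuous_belowMean.comp continuous_snd
    have cR : Continuous fun z : ℝ × ℝ => belowMoment ν r α z.2 :=
      (h.continuous_belowMoment h0.le).comp continuous_snd
    have c1 : ContinuousAt (fun z : ℝ × ℝ => z.1 ^ (-α)) y :=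
      continuousAt_fst.rpow_const (Or.inl hy0.ne')
    have c2 : Continuous fun z : ℝ × ℝ => z.1 ^ (1 - α) :=
      (Real.continuous_rpow_const (by linarith)).comp continuous_fst
    have c3 : Continuous fun z : ℝ × ℝ => (1 - belowMean ν r z.2) ^ α :=
      (Real.continuous_rpow_const h0.le).comp (continuous_const.sub cT)
    have c4 : Continuous fun z : ℝ × ℝ => (1 - z.1 * belowMass ν r z.2) ^ (1 - α) :=
      (Real.continuous_rpow_const (by linarith)).comp
        (continuous_const.sub (continuous_fst.mul cs))
    exact ((((c3.mul c4).add (c2.mul cR)).continuousAt.sub ((continuousAt_const.add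
      ((continuousAt_const.mul c1).mul cR.continuousAt)).div cs.continuousAt hys.ne')).add
      (continuous_const.mul continuous_fst).continuousAt).continuousWithinAt
  obtain ⟨z, hz, hzmax⟩ := (h.isCompact_underProvided h0.le).exists_isMaxOn ⟨_, hmem⟩ hcont
  obtain ⟨hz0, hz1, hzρ, hzs⟩ := hpos z hz
  have hFz : F (a, ρ) ≤ F z := hzmax hmem
  have hzδ : c / (2 * B) < belowMass ν r z.2 := by
    refine hδlt hzs ?_
    have := hFle z hz0 hz1 hzρ hzs
    linarith
  have hzL := h.eq_of_isMaxOn hα hγ hc ha hδ hz hzδ hzmax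
  have hθz : (c + (1 - γ) * z.1 ^ (-α) * belowMoment ν r α z.2) / belowMass ν r z.2
      * belowMass ν r z.2 = c + (1 - γ) * z.1 ^ (-α) * belowMoment ν r α z.2 :=
    div_mul_cancel₀ _ hzs.ne'
  refine ⟨z.1, z.2, _, ⟨hzρ, hz0, one_pos, ?_, ?_, hθz,
    (threshold_feasible_iff hz0 hzs hθz).2 hz.2.2.1⟩, ?_⟩
  · have := h.belowMean_le_mul z.2
    rw [hzL] at this
    rw [one_mul]
    exact le_of_mul_le_mul_right this hzs
  · rw [hzL]; ring
  · have e1 : thresholdProfit ν r α c a ρ k θ = F (a, ρ) := by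
      have eQ : 1 - a * belowMass ν r ρ = k * (1 - belowMean ν r ρ) := by linarith
      have eθ : θ = (c + (1 - γ) * a ^ (-α) * belowMoment ν r α ρ) / belowMass ν r ρ := by
        rw [eq_div_iff hs.ne', hθ]
      have eP : (1 - belowMean ν r ρ) ^ α * (1 - belowMean ν r ρ) ^ (1 - α)
          = 1 - belowMean ν r ρ := by
        rw [← Real.rpow_add hP]; simp
      simp only [hF, thresholdProfit, reducedProfit]
      rw [eQ, Real.mul_rpow hk0.le hP.le, ← eθ]
      linear_combination (-(k ^ (1 - α))) * eP
    have hPz : 0 ≤ 1 - belowMean ν r z.2 := sub_nonneg.2 (h.belowMean_le_one hzρ)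
    have e2 : F z = thresholdProfit ν r α c z.1 z.2 1
        ((c + (1 - γ) * z.1 ^ (-α) * belowMoment ν r α z.2) / belowMass ν r z.2) := by
      simp only [hF, thresholdProfit, reducedProfit, ← hzL, Real.one_rpow, one_mul]
      rw [← Real.rpow_add_of_nonneg hPz h0.le (by linarith), add_sub_cancel, Real.rpow_one]
    rw [e1, ← e2]
    exact hFz

end IsAtomlessRatio

/-! ### Every content density is dominated by a threshold profile -/

namespace IsAtomlessRatio

variable {Ω : Type*} [MeasurableSpace Ω] {ν : Measure Ω} [IsProbabilityMeasure ν] {r : Ω → ℝ}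
  {l u : ℝ}

/-- For a given share of GenAI, a threshold at which the feasibility condition is an equality
minimizes the profit from GenAI; a feasible threshold does so among the smaller thresholds. -/
theorem threshold_revenue_le (h : IsAtomlessRatio ν r l u) {α γ c a ρ ρ' θ : ℝ} (hα : 0 ≤ α)
    (hγ : γ ≤ 1) (ha : 0 < a) (hρ : 0 ≤ ρ)
    (hθ : θ * belowMass ν r ρ = c + (1 - γ) * a ^ (-α) * belowMoment ν r α ρ)
    (hcase : θ = (1 - γ) * a ^ (-α) * ρ ^ α ∨ (1 - γ) * a ^ (-α) * ρ ^ α ≤ θ ∧ ρ' ≤ ρ) :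
    θ * belowMass ν r ρ' ≤ c + (1 - γ) * a ^ (-α) * belowMoment ν r α ρ' := by
  have hκ : 0 ≤ (1 - γ) * a ^ (-α) := mul_nonneg (sub_nonneg.2 hγ) (Real.rpow_nonneg ha.le _)
  rcases le_total ρ' ρ with hle | hle
  · have hθ' : (1 - γ) * a ^ (-α) * ρ ^ α ≤ θ := by
      rcases hcase with e | e
      exacts [e.ge, e.1]
    have e1 := mul_le_mul_of_nonneg_left (h.belowMoment_sub_le hα hle) hκ
    have e2 := mul_le_mul_of_nonneg_right hθ' (sub_nonneg.2 (h.belowMass_mono hle))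
    linarith
  · rcases hcase with e | e
    · have e1 := mul_le_mul_of_nonneg_left (h.belowMoment_sub_ge hα hle hρ) hκ
      rw [e] at hθ ⊢
      linarith
    · rw [le_antisymm e.2 hle]; exact hθ.le

theorem belowMass_pos_of_slack (h : IsAtomlessRatio ν r l u) {α γ c x ρ : ℝ} (hα : 0 ≤ α)
    (hx : 0 < c * x) (h0 : c * x + (1 - γ) * (belowMoment ν r α ρ - ρ ^ α * belowMass ν r ρ) = 0) :
    0 < belowMass ν r ρ := by
  refine lt_of_le_of_ne (belowMass_nonneg h ρ) fun heq => ?_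
  have e1 := h.belowMoment_le_mul hα ρ
  have e2 := belowMoment_nonneg h α ρ
  rw [← heq, mul_zero] at e1
  rw [← heq, mul_zero, le_antisymm e1 e2] at h0
  linarith

/-- If the unconstrained optimal threshold `ρ` for a share `a` of GenAI is infeasible, then there is
a smaller share at which the unconstrained optimum is an equilibrium without compensation. -/
theorem exists_uncompensated_profile (h : IsAtomlessRatio ν r l u) {α γ c a ρ : ℝ}
    (hα : α ∈ Set.Ioo (0 : ℝ) 1) (hc : 0 < c) (hρ : ρ ∈ Set.Icc l u)
    (hopt : ρ * (1 - a * belowMass ν r ρ) = a * (1 - belowMean ν r ρ))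
    (hinf : c * a ^ α + (1 - γ) * (belowMoment ν r α ρ - ρ ^ α * belowMass ν r ρ) < 0) :
    ∃ a' ρ' k θ, IsThresholdProfile ν r α γ c l u a' ρ' k θ ∧ k ≤ 1 ∧ a' ≤ a ∧ k * ρ' = a' ∧
      thresholdProfit ν r α c a' ρ' k θ = γ * (k ^ (1 - α) * (1 - belowMean ν r ρ')
        + a' ^ (1 - α) * belowMoment ν r α ρ') := by
  obtain ⟨h0, h1⟩ := hα
  have cs := h.continuous_belowMass
  have cT := h.continuous_belowMean
  have cR := h.continuous_belowMoment h0.le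
  have crp : Continuous fun t : ℝ => t ^ α := Real.continuous_rpow_const h0.le
  -- `N t` is the expectation of `max r t`
  set N : ℝ → ℝ := fun t => 1 - belowMean ν r t + t * belowMass ν r t with hN
  have hN1 : ∀ t, 1 ≤ N t := fun t => by
    have := h.belowMean_le_mul t
    simp only [hN]; linarith
  have hN0 : ∀ t, 0 < N t := fun t => zero_lt_one.trans_le (hN1 t)
  have cN : Continuous N := (continuous_const.sub cT).add (continuous_id.mul cs)
  have haN : a = ρ / N ρ := by
    rw [eq_div_iff (hN0 ρ).ne']; simp only [hN]; linarith
  have hcont : ContinuousOn (fun t => c * (t / N t) ^ α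
      + (1 - γ) * (belowMoment ν r α t - t ^ α * belowMass ν r t)) (Set.Icc l ρ) :=
    ((continuous_const.mul (crp.comp (continuous_id.div cN fun t => (hN0 t).ne'))).add
      (continuous_const.mul (cR.sub (crp.mul cs)))).continuousOn
  obtain ⟨t, ⟨hlt, htρ⟩, ht⟩ := intermediate_value_Icc' hρ.1 hcont
    (show (0 : ℝ) ∈ Set.Icc _ _ from ⟨by rw [← haN]; exact hinf.le, by
      have := Real.rpow_nonneg (div_nonneg h.pos.le (hN0 l).le) α
      simp only [belowMoment, belowMass, h.below_lower]
      nlinarith⟩)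
  simp only at ht
  have ht0 : 0 < t := h.pos.trans_le hlt
  have hb0 : 0 < t / N t := div_pos ht0 (hN0 t)
  have hs := h.belowMass_pos_of_slack h0.le
    (mul_pos hc (Real.rpow_pos_of_pos hb0 α)) ht
  set b := t / N t with hb
  set k := 1 / N t with hk
  have hk0 : 0 < k := one_div_pos.2 (hN0 t)
  have hkt : k * t = b := by rw [hk, hb]; ring
  have hbal : k * (1 - belowMean ν r t) + b * belowMass ν r t = 1 := by
    rw [← hkt]
    calc _ = k * N t := by simp only [hN]; ring
      _ = 1 := one_div_mul_cancel (hN0 t).ne'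
  set θ := (c + (1 - γ) * b ^ (-α) * belowMoment ν r α t) / belowMass ν r t with hθ_def
  have hθ : θ * belowMass ν r t = c + (1 - γ) * b ^ (-α) * belowMoment ν r α t :=
    div_mul_cancel₀ _ hs.ne'
  have hθeq : θ = (1 - γ) * b ^ (-α) * t ^ α := by
    have e := threshold_slack_eq hb0 hθ
    rw [ht] at e
    have := (mul_eq_zero.1 e).resolve_right
      (mul_pos hs (Real.rpow_pos_of_pos hb0 α)).ne'
    linarith
  have hθk : θ = (1 - γ) * k ^ (-α) := by
    rw [hθeq, mul_assoc, ← hkt, Real.mul_rpow hk0.le ht0.le, mul_assoc, ← Real.rpow_add ht0]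
    simp
  have hba : b ≤ a := by
    rw [haN, hb, div_le_div_iff₀ (hN0 t) (hN0 ρ)]
    have e1 := h.belowMean_sub_ge htρ
    have e2 := h.belowMean_le_one hρ
    have e3 := mul_le_mul_of_nonneg_left e1 ht0.le
    have e4 : t * (belowMass ν r ρ - belowMass ν r t) ≤ 1 - belowMean ν r t := by linarith
    have e5 := mul_le_mul_of_nonneg_left e4 (sub_nonneg.2 htρ)
    simp only [hN]
    nlinarith
  refine ⟨b, t, k, θ, ⟨⟨hlt, htρ.trans hρ.2⟩, hb0, hk0, hkt.ge, hbal, hθ, hθeq.ge⟩,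
    (div_le_one (hN0 t)).2 (hN1 t), hba, hkt, ?_⟩
  have ek : k ^ (1 - α) = k ^ (-α) * k := by
    rw [show 1 - α = -α + 1 by ring, Real.rpow_add_one hk0.ne']
  have eb : b ^ (1 - α) = b ^ (-α) * b := by
    rw [show 1 - α = -α + 1 by ring, Real.rpow_add_one hb0.ne']
  unfold thresholdProfit
  rw [ek, eb]
  linear_combination θ * hbal - b * hθ - k * (1 - belowMean ν r t) * hθk

/-- A content density `q` with share `a` of GenAI, and a scheme under which it costs at
least what the equilibrium conditions impose, are dominated by a threshold profile. Here
`θ - c` is the profit from GenAI, and the assumption `hθ` expresses that it is generated by the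
revenue `θ` where `q > a` and by at least the uncompensated revenue elsewhere. -/
theorem exists_profile_ge (h : IsAtomlessRatio ν r l u) {α γ c a b θ π : ℝ}
    (hα : α ∈ Set.Ioo (0 : ℝ) 1) (hγ0 : 0 ≤ γ) (hγ : γ ≤ 2 * α / (α + 1)) (hc : 0 < c) (ha : 0 < a)
    {q : Ω → ℝ} (hq : Measurable q) (haq : ∀ x, a ≤ q x) (hqb : ∀ x, q x ≤ b)
    (hq1 : ∫ x, q x ∂ν = 1) (hs : 0 < ν.real {x | a < q x}ᶜ)
    (hθ : c + (1 - γ) * a ^ (-α) * ∫ x in {x | a < q x}ᶜ, r x ^ α ∂ν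
      ≤ θ * ν.real {x | a < q x}ᶜ)
    (hπ : π ≤ γ * ∫ x, r x ^ α * q x ^ (1 - α) ∂ν)
    (hπ' : π ≤ ∫ x, r x ^ α * q x ^ (1 - α) ∂ν - θ + c * a) :
    ∃ a' ρ k θ', IsThresholdProfile ν r α γ c l u a' ρ k θ' ∧ k ≤ 1 ∧
      π ≤ thresholdProfit ν r α c a' ρ k θ' := by
  have hα' := hα
  obtain ⟨h0, h1⟩ := hα'
  have hγ1 : γ < 1 := hγ.trans_lt ((div_lt_one (by linarith)).2 (by linarith))
  have cs := h.continuous_belowMass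
  have cT := h.continuous_belowMean
  have cR := h.continuous_belowMoment h0.le
  have crp : Continuous fun t : ℝ => t ^ α := Real.continuous_rpow_const h0.le
  have hBm : MeasurableSet {x | a < q x} := measurableSet_lt measurable_const hq
  have hiq : Integrable q ν := .of_bound hq.aestronglyMeasurable b (.of_forall fun x => by
    rw [Real.norm_of_nonneg (ha.le.trans (haq x))]; exact hqb x)
  have hκ : 0 ≤ (1 - γ) * a ^ (-α) := mul_nonneg (by linarith) (Real.rpow_nonneg ha.le _)
  have ha1 : a ≤ 1 := by
    rw [← hq1]
    simpa using integral_mono (integrable_const a) hiq haq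
  have hcompl : ν.real {x | a < q x}ᶜ = 1 - ν.real {x | a < q x} := probReal_compl_eq_one_sub hBm
  -- the threshold below which there is as much as outside of `{a < q}`
  obtain ⟨τ, hτ, hsτ⟩ := h.exists_belowMass_eq hs.le measureReal_le_one
  have hτs : 0 < belowMass ν r τ := by rw [hsτ]; exact hs
  have hθτ : c + (1 - γ) * a ^ (-α) * belowMoment ν r α τ ≤ θ * belowMass ν r τ := by
    have := h.belowMoment_le_setIntegral h0.le (h.pos.le.trans hτ.1) hBm.compl hsτ
    rw [hsτ]
    refine le_trans ?_ hθ
    gcongr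
  have hca : 0 < c * a ^ α := mul_pos hc (Real.rpow_pos_of_pos ha α)
  have hrev : ∀ t, 0 < belowMass ν r t →
      ((c + (1 - γ) * a ^ (-α) * belowMoment ν r α t) / belowMass ν r t) * belowMass ν r t
        = c + (1 - γ) * a ^ (-α) * belowMoment ν r α t :=
    fun t ht => div_mul_cancel₀ _ ht.ne'
  -- lower the threshold to a feasible one, which also lowers the profit from GenAI
  obtain ⟨ρ, θ₁, hρl, hρτ, hρs, hθ₁, hfeas, hθle⟩ : ∃ ρ θ₁, l ≤ ρ ∧ ρ ≤ τ ∧ 0 < belowMass ν r ρ ∧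
      θ₁ * belowMass ν r ρ = c + (1 - γ) * a ^ (-α) * belowMoment ν r α ρ ∧
      (1 - γ) * a ^ (-α) * ρ ^ α ≤ θ₁ ∧ θ₁ ≤ θ := by
    by_cases hf : 0 ≤ c * a ^ α + (1 - γ) * (belowMoment ν r α τ - τ ^ α * belowMass ν r τ)
    · refine ⟨τ, _, hτ.1, le_rfl, hτs, hrev τ hτs,
        (threshold_feasible_iff ha hτs (hrev τ hτs)).2 hf, ?_⟩
      rwa [div_le_iff₀ hτs]
    · have hcont : ContinuousOn (fun t => c * a ^ α
          + (1 - γ) * (belowMoment ν r α t - t ^ α * belowMass ν r t)) (Set.Icc l τ) :=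
        (continuous_const.add (continuous_const.mul (cR.sub (crp.mul cs)))).continuousOn
      obtain ⟨t, ⟨hlt, htτ⟩, ht⟩ := intermediate_value_Icc' hτ.1 hcont
        (show (0 : ℝ) ∈ Set.Icc _ _ from ⟨(not_le.1 hf).le, by
          simp only [belowMoment, belowMass, h.below_lower]
          linarith⟩)
      simp only at ht
      have hts := h.belowMass_pos_of_slack h0.le hca ht
      have e := threshold_slack_eq ha (hrev t hts)
      rw [ht] at e
      have e' := (mul_eq_zero.1 e).resolve_right (mul_pos hts (Real.rpow_pos_of_pos ha α)).ne'
      refine ⟨t, _, hlt, htτ, hts, hrev t hts, by linarith, ?_⟩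
      have := h.threshold_revenue_le (ρ' := τ) h0.le hγ1.le ha (h.pos.le.trans hlt) (hrev t hts)
        (Or.inl (by linarith))
      exact le_of_mul_le_mul_right (this.trans hθτ) hτs
  have hρ : ρ ∈ Set.Icc l u := ⟨hρl, hρτ.trans hτ.2⟩
  have hρ0 : 0 < ρ := h.pos.trans_le hρl
  have hBs : ν.real {x | a < q x} ≤ 1 - belowMass ν r ρ := by
    have := h.belowMass_mono hρτ
    linarith
  by_cases hf2 : 0 ≤ ρ * (1 - a * belowMass ν r ρ) - a * (1 - belowMean ν r ρ)
  · obtain ⟨k, hk0, hakρ, hbal, hkP⟩ : ∃ k, 0 < k ∧ a ≤ k * ρ ∧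
        k * (1 - belowMean ν r ρ) + a * belowMass ν r ρ = 1 ∧
        (k ≤ 1 ∨ 0 < 1 - belowMean ν r ρ) := by
      rcases (sub_nonneg.2 (h.belowMean_le_one hρ)).eq_or_lt with hP | hP
      · -- no type is above the threshold, so that all the content is made by GenAI
        have hs1 : belowMass ν r ρ = 1 :=
          le_antisymm (belowMass_le_one ν r ρ) (by linarith [h.belowMean_le_belowMass hρ])
        have hB0 : ν {x | a < q x} = 0 := by
          rw [hs1, sub_self] at hBs
          exact (measureReal_eq_zero_iff).1 (le_antisymm hBs measureReal_nonneg)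
        have hae : ∀ᵐ x ∂ν, q x ≤ a := by
          rw [ae_iff]; simpa using hB0
        have h1a : 1 ≤ a := by
          rw [← hq1]
          simpa using integral_mono_ae hiq (integrable_const a) hae
        have := h.belowMean_le_mul ρ
        rw [hs1] at this ⊢
        exact ⟨1, one_pos, by linarith, by linarith, Or.inl le_rfl⟩
      · have hak : a ≤ (1 - a * belowMass ν r ρ) / (1 - belowMean ν r ρ) * ρ := by
          rw [div_mul_eq_mul_div, le_div_iff₀ hP]
          linarith
        refine ⟨(1 - a * belowMass ν r ρ) / (1 - belowMean ν r ρ), ?_, hak, ?_, Or.inr hP⟩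
        · by_contra hn
          nlinarith
        · rw [div_mul_cancel₀ _ hP.ne']; ring
    have hC := h.integral_quality_le hα ha hk0 hakρ hbal hq haq hqb hq1 (Or.inr hBs)
    have hprof : IsThresholdProfile ν r α γ c l u a ρ k θ₁ :=
      ⟨hρ, ha, hk0, hakρ, hbal, hθ₁, hfeas⟩
    have hle : π ≤ thresholdProfit ν r α c a ρ k θ₁ := by
      unfold thresholdProfit
      linarith
    rcases le_or_gt k 1 with hk1 | hk1
    · exact ⟨a, ρ, k, θ₁, hprof, hk1, hle⟩
    · obtain ⟨a', ρ', θ', hprof', hle'⟩ := h.exists_profile_level_one hα hγ hc hprof hk1.le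
        (hkP.resolve_left (not_le.2 hk1))
      exact ⟨a', ρ', 1, θ', hprof', le_rfl, hle.trans hle'⟩
  · -- the set above `ρ` is larger than optimal for the share `a`: `t` is the optimal threshold
    have hcont : ContinuousOn (fun t => t * (1 - a * belowMass ν r t) - a * (1 - belowMean ν r t))
        (Set.Icc ρ u) := by
      apply Continuous.continuousOn
      fun_prop
    obtain ⟨t, ⟨hρt, htu⟩, ht⟩ := intermediate_value_Icc hρ.2 hcont
      (show (0 : ℝ) ∈ Set.Icc _ _ from ⟨(not_le.1 hf2).le, by
        simp only [h.belowMean_upper, h.belowMass_upper]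
        have := h.pos.le.trans h.le_upper
        nlinarith⟩)
    simp only at ht
    have htI : t ∈ Set.Icc l u := ⟨hρl.trans hρt, htu⟩
    have ht0 : 0 < t := hρ0.trans_le hρt
    have hts : 0 < belowMass ν r t := hρs.trans_le (h.belowMass_mono hρt)
    by_cases hf : 0 ≤ c * a ^ α + (1 - γ) * (belowMoment ν r α t - t ^ α * belowMass ν r t)
    · have hk0 : 0 < a / t := div_pos ha ht0
      have hkt : a / t * t = a := div_mul_cancel₀ a ht0.ne'
      have hbal : a / t * (1 - belowMean ν r t) + a * belowMass ν r t = 1 := by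
        rw [div_mul_eq_mul_div, div_add' _ _ _ ht0.ne', div_eq_one_iff_eq ht0.ne']
        linarith
      have hk1 : a / t ≤ 1 := by
        rw [div_le_one ht0]
        nlinarith [h.belowMean_le_mul t]
      have hC := h.integral_quality_le hα ha hk0 hkt.ge hbal hq haq hqb hq1 (Or.inl hkt)
      have hfeas' := (threshold_feasible_iff ha hts (hrev t hts)).2 hf
      refine ⟨a, t, a / t, _, ⟨htI, ha, hk0, hkt.ge, hbal, hrev t hts, hfeas'⟩, hk1, ?_⟩
      have := h.threshold_revenue_le (ρ' := ρ) h0.le hγ1.le ha ht0.le (hrev t hts)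
        (Or.inr ⟨hfeas', hρt⟩)
      rw [← hθ₁] at this
      have := le_of_mul_le_mul_right this hρs
      unfold thresholdProfit
      linarith
    · obtain ⟨a', ρ', k, θ', hprof, hk1, haa, hkρ, hval⟩ :=
        h.exists_uncompensated_profile (γ := γ) hα hc htI (by linarith) (not_le.1 hf)
      refine ⟨a', ρ', k, θ', hprof, hk1, ?_⟩
      have hC := h.integral_quality_le hα hprof.share_pos hprof.level_pos hkρ.ge hprof.balance hq
        (fun x => haa.trans (haq x)) hqb hq1 (Or.inl hkρ)
      rw [hval]
      exact hπ.trans (mul_le_mul_of_nonneg_left hC hγ0)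

end IsAtomlessRatio

/-! ### The distribution of the ratio -/

theorem ite_eq_indicator_add {Ω : Type*} (r : Ω → ℝ) (f f' : ℝ → ℝ) (ρ : ℝ) :
    (fun x => if ρ ≤ r x then f (r x) else f' (r x))
      = fun x => {x | ρ ≤ r x}.indicator (fun x => f (r x)) x
        + {x | r x < ρ}.indicator (fun x => f' (r x)) x := by
  ext x
  by_cases hx : ρ ≤ r x
  · simp [Set.indicator, hx, not_lt.2 hx]
  · simp [Set.indicator, hx, not_le.1 hx]

namespace IsAtomlessRatio

variable {Ω : Type*} [MeasurableSpace Ω] {ν : Measure Ω} {r : Ω → ℝ} {l u : ℝ} {f f' : ℝ → ℝ}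
  {α γ c a ρ k θ : ℝ}

theorem integrable_ite (h : IsAtomlessRatio ν r l u) (hf : Integrable (fun x => f (r x)) ν)
    (hf' : Integrable (fun x => f' (r x)) ν) (ρ : ℝ) :
    Integrable (fun x => if ρ ≤ r x then f (r x) else f' (r x)) ν := by
  rw [ite_eq_indicator_add]
  exact (hf.indicator (measurableSet_le measurable_const h.measurable)).add
    (hf'.indicator (h.measurableSet_below ρ))

/-- The revenue `θ` of manual creation is at least its uncompensated part. -/
theorem revenue_le_of_profile (h : IsAtomlessRatio ν r l u) (hα : 0 ≤ α) (hγ : γ ≤ 1)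
    (hprof : IsThresholdProfile ν r α γ c l u a ρ k θ) : (1 - γ) * k ^ (-α) ≤ θ := by
  obtain ⟨hρ, ha, hk0, haρ, -, -, hfeas⟩ := hprof
  have hρ0 : 0 < ρ := h.pos.trans_le hρ.1
  have e1 : k ^ (-α) ≤ a ^ (-α) * ρ ^ α := by
    rw [Real.rpow_neg hk0.le, Real.rpow_neg ha.le, inv_le_iff_one_le_mul₀ (by positivity),
      mul_assoc, ← Real.mul_rpow hρ0.le hk0.le, inv_mul_eq_div,
      one_le_div (by positivity), mul_comm ρ k]
    exact Real.rpow_le_rpow ha.le haρ hα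
  have e2 := mul_le_mul_of_nonneg_left e1 (sub_nonneg.2 hγ)
  linarith

variable [IsProbabilityMeasure ν]

theorem integral_ite (h : IsAtomlessRatio ν r l u) (hf : Integrable (fun x => f (r x)) ν)
    (hf' : Integrable (fun x => f' (r x)) ν) (ρ : ℝ) :
    ∫ x, (if ρ ≤ r x then f (r x) else f' (r x)) ∂ν
      = ∫ x, f (r x) ∂ν - below ν r f ρ + below ν r f' ρ := by
  have hm : MeasurableSet {x | ρ ≤ r x} := measurableSet_le measurable_const h.measurable
  rw [ite_eq_indicator_add, integral_add (hf.indicator hm)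
    (hf'.indicator (h.measurableSet_below ρ)), integral_indicator hm, h.integral_compl hf,
    h.below_eq_integral_indicator f']

theorem integrable_profile_revenue (h : IsAtomlessRatio ν r l u) (hα : 0 ≤ α) :
    Integrable (fun x => if ρ ≤ r x then θ else (1 - γ) * a ^ (-α) * r x ^ α) ν :=
  h.integrable_ite (f := fun _ => θ) (f' := fun t => (1 - γ) * a ^ (-α) * t ^ α)
    (h.integrable_one θ) ((h.integrable_rpow hα).const_mul _) ρ

theorem integral_profile_revenue (h : IsAtomlessRatio ν r l u) (hα : 0 ≤ α)
    (hprof : IsThresholdProfile ν r α γ c l u a ρ k θ) :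
    ∫ x, (if ρ ≤ r x then θ else (1 - γ) * a ^ (-α) * r x ^ α) ∂ν = θ - c := by
  rw [h.integral_ite (f := fun _ => θ) (f' := fun t => (1 - γ) * a ^ (-α) * t ^ α)
    (h.integrable_one θ) ((h.integrable_rpow hα).const_mul _), below_const, below_const_mul]
  simp only [integral_const, probReal_univ, one_smul]
  linarith [hprof.revenue_eq]

theorem integral_profile_automated (h : IsAtomlessRatio ν r l u)
    (hprof : IsThresholdProfile ν r α γ c l u a ρ k θ) :
    ∫ x, (if ρ ≤ r x then (1 - k) * r x + a else r x) ∂ν = a := by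
  have hi : Integrable (fun x => (1 - k) * id (r x) + a) ν :=
    (h.integrable_id.const_mul _).add (integrable_const _)
  have e1 : ∫ x, ((1 - k) * id (r x) + a) ∂ν = (1 - k) + a := by
    rw [integral_add (h.integrable_id.const_mul _) (integrable_const _), integral_const_mul]
    simp [h.integral_eq_one]
  have e2 : below ν r (fun t => (1 - k) * id t + a) ρ
      = (1 - k) * belowMean ν r ρ + a * belowMass ν r ρ := by
    rw [← below_const, ← below_const_mul]
    exact integral_add (h.integrable_id.const_mul _).integrableOn (integrable_const _)
  have e3 := h.integral_ite (f := fun t => (1 - k) * id t + a) (f' := id) hi h.integrable_id ρ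
  rw [e1, e2] at e3
  simp only [id] at e3
  rw [e3]
  change _ + belowMean ν r ρ = a
  linarith [hprof.balance]

theorem profile_profit_eq (h : IsAtomlessRatio ν r l u) (hα : 0 ≤ α)
    (hprof : IsThresholdProfile ν r α γ c l u a ρ k θ) :
    γ * ∫ x, (if ρ ≤ r x then k ^ (1 - α) * r x else a ^ (1 - α) * r x ^ α) ∂ν
      - ∫ x, (if ρ ≤ r x then (θ - (1 - γ) * k ^ (-α)) * k * r x else 0) ∂ν
      = thresholdProfit ν r α c a ρ k θ := by
  obtain ⟨-, ha, hk0, -, hbal, hθ, -⟩ := hprof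
  have e1 := h.integral_ite (f := fun t => k ^ (1 - α) * id t) (f' := fun t => a ^ (1 - α) * t ^ α)
    (h.integrable_id.const_mul _) ((h.integrable_rpow hα).const_mul _) ρ
  have e2 := h.integral_ite (f := fun t => (θ - (1 - γ) * k ^ (-α)) * k * id t) (f' := fun _ => 0)
    (h.integrable_id.const_mul _) (h.integrable_one 0) ρ
  rw [integral_const_mul, below_const_mul, below_const_mul] at e1
  rw [integral_const_mul, below_const, below_const_mul] at e2
  simp only [id, h.integral_eq_one] at e1 e2
  rw [e1, e2]
  have ek : k ^ (1 - α) = k ^ (-α) * k := by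
    rw [show 1 - α = -α + 1 by ring, Real.rpow_add_one hk0.ne']
  have ea : a ^ (1 - α) = a ^ (-α) * a := by
    rw [show 1 - α = -α + 1 by ring, Real.rpow_add_one ha.ne']
  rw [thresholdProfit, ek, ea]
  change γ * (_ - _ * belowMean ν r ρ + _ * belowMoment ν r α ρ)
    - (_ - _ * belowMean ν r ρ + _) = _
  linear_combination (-θ) * hbal + a * hθ

theorem le_of_profile (h : IsAtomlessRatio ν r l u) (hγ : γ ≤ 1) (hc : 0 < c)
    (hprof : IsThresholdProfile ν r α γ c l u a ρ k θ) : c ≤ θ := by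
  have e1 := mul_nonneg (mul_nonneg (sub_nonneg.2 hγ) (Real.rpow_nonneg hprof.share_pos.le (-α)))
    (belowMoment_nonneg h α ρ)
  have e2 := belowMass_nonneg h ρ
  have e3 := belowMass_le_one ν r ρ
  have e5 := hprof.revenue_eq
  have e4 : 0 ≤ θ := by
    by_contra hn
    nlinarith
  nlinarith

end IsAtomlessRatio

theorem sum_creationAction (f : CreationAction → ℝ) :
    ∑ i, f i = f CreationAction.H + f CreationAction.AI + f CreationAction.O := by
  have : ∑ i, f i = f CreationAction.H + (f CreationAction.AI + (f CreationAction.O + 0)) := rfl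
  rw [this]; ring

section

variable {d : ℕ} {X : Set (EuclideanSpace ℝ (Fin d))} {p g : X → ℝ}

theorem ContentPlatform.IsProbDensity.pos (hp : IsProbDensity p) (x : X) : 0 < p x := by
  obtain ⟨m, hm, h⟩ := hp.lower_bound
  exact hm.trans_le (h x)

theorem ContentPlatform.IsProbDensity.measurable (hp : IsProbDensity p) : Measurable p :=
  hp.upperSemicontinuous.measurable

theorem ContentPlatform.IsProbDensity.integrable (hp : IsProbDensity p) : Integrable p := by
  by_contra h
  have := hp.integral_eq_one
  rw [integral_undef h] at this
  exact zero_ne_one this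

theorem ContentPlatform.IsProbDensity.exists_le (hX : IsCompact X) (hp : IsProbDensity p) :
    ∃ M, ∀ x, p x ≤ M := by
  have : CompactSpace X := isCompact_iff_compactSpace.1 hX
  obtain ⟨M, hM⟩ := UpperSemicontinuousOn.bddAbove_of_isCompact isCompact_univ
    (upperSemicontinuousOn_univ_iff.2 hp.upperSemicontinuous)
  exact ⟨M, fun x => hM ⟨x, trivial, rfl⟩⟩

theorem isProbabilityMeasure_densityMeasure (hg : IsProbDensity g) :
    IsProbabilityMeasure (densityMeasure g) := by
  constructor
  rw [densityMeasure, withDensity_apply _ MeasurableSet.univ, Measure.restrict_univ,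
    ← ofReal_integral_eq_lintegral_ofReal hg.integrable (.of_forall fun x => (hg.pos x).le),
    hg.integral_eq_one, ENNReal.ofReal_one]

theorem integral_densityMeasure (hg : IsProbDensity g) (f : X → ℝ) :
    ∫ x, f x ∂(densityMeasure g) = ∫ x, f x * g x := by
  rw [densityMeasure, integral_withDensity_eq_integral_toReal_smul hg.measurable.ennreal_ofReal
    (.of_forall fun x => ENNReal.ofReal_lt_top)]
  congr 1; ext x
  rw [ENNReal.toReal_ofReal (hg.pos x).le, smul_eq_mul, mul_comm]

theorem integrable_densityMeasure_iff (hg : IsProbDensity g) (f : X → ℝ) :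
    Integrable f (densityMeasure g) ↔ Integrable (fun x => f x * g x) := by
  rw [densityMeasure, integrable_withDensity_iff hg.measurable.ennreal_ofReal
    (.of_forall fun x => ENNReal.ofReal_lt_top)]
  simp_rw [fun x => ENNReal.toReal_ofReal (hg.pos x).le]

theorem ratio_mul (hg : IsProbDensity g) (x : X) : ratio p g x * g x = p x :=
  div_mul_cancel₀ _ (hg.pos x).ne'

/-- Under the distribution with density `g`, the ratio `p / g` has mean `1`; it is atomless, since
the distributions with densities `p` and `g` have the same null sets. -/
theorem isAtomlessRatio_ratio (hX : IsCompact X) (hp : IsProbDensity p) (hg : IsProbDensity g)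
    (hr : HasPDF (ratio p g) (densityMeasure p) volume) :
    IsAtomlessRatio (densityMeasure g) (ratio p g) (⨅ x, ratio p g x) (⨆ x, ratio p g x) := by
  obtain ⟨Mp, hMp⟩ := hp.exists_le hX
  obtain ⟨Mg, hMg⟩ := hg.exists_le hX
  obtain ⟨mp, hmp, hmp'⟩ := hp.lower_bound
  obtain ⟨mg, hmg, hmg'⟩ := hg.lower_bound
  have hprob := isProbabilityMeasure_densityMeasure hg
  have : Nonempty X := nonempty_of_isProbabilityMeasure (densityMeasure g)
  have x₀ : X := Classical.arbitrary X
  have hMg0 : 0 < Mg := (hg.pos x₀).trans_le (hMg x₀)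
  have hMp0 : 0 < Mp := (hp.pos x₀).trans_le (hMp x₀)
  have hlow : ∀ x, mp / Mg ≤ ratio p g x := fun x =>
    div_le_div₀ (hp.pos x).le (hmp' x) (hg.pos x) (hMg x)
  have hup : ∀ x, ratio p g x ≤ Mp / mg := fun x =>
    div_le_div₀ hMp0.le (hMp x) hmg (hmg' x)
  have hmeas : Measurable (ratio p g) := hp.measurable.div hg.measurable
  refine ⟨hmeas, (div_pos hmp hMg0).trans_le (le_ciInf hlow),
    fun x => ciInf_le ⟨_, Set.forall_mem_range.2 hlow⟩ x,
    fun x => le_ciSup (f := ratio p g) ⟨_, Set.forall_mem_range.2 hup⟩ x, ?_, fun t => ?_⟩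
  · rw [integral_densityMeasure hg]
    simp_rw [ratio_mul hg]
    exact hp.integral_eq_one
  · have hvol : (densityMeasure p) {x | ratio p g x = t} = 0 := by
      have := hr.absolutelyContinuous (measure_singleton t)
      rwa [Measure.map_apply hmeas (measurableSet_singleton t)] at this
    have h1 : (volume : Measure X) ≪ densityMeasure p :=
      withDensity_absolutelyContinuous' hp.measurable.ennreal_ofReal.aemeasurable
        (.of_forall fun x => (ENNReal.ofReal_pos.2 (hp.pos x)).ne')
    exact withDensity_absolutelyContinuous _ _ (h1 hvol)

/-- The quality of a content density, as an expectation under the distribution with density `g`. -/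
theorem integral_quality_eq (hp : IsProbDensity p) (hg : IsProbDensity g) (α : ℝ)
    (q : ContentDensity X) :
    ∫ x, p x ^ α * q x ^ (1 - α)
      = ∫ x, ratio p g x ^ α * (q x / g x) ^ (1 - α) ∂(densityMeasure g) := by
  rw [integral_densityMeasure hg]
  congr 1; ext x
  have hq : 0 ≤ q x := by
    obtain ⟨-, ⟨m, hm, h⟩, -⟩ := q.2
    exact hm.le.trans (h x)
  have hg0 := hg.pos x
  have e : g x ^ α * g x ^ (1 - α) = g x := by rw [← Real.rpow_add hg0]; simp
  rw [ratio, Real.div_rpow (hp.pos x).le hg0.le, Real.div_rpow hq hg0.le]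
  have h1 := (Real.rpow_pos_of_pos hg0 α).ne'
  have h2 := (Real.rpow_pos_of_pos hg0 (1 - α)).ne'
  rw [div_mul_div_comm, e, div_mul_cancel₀ _ hg0.ne']

/-! ### Threshold profiles are equilibria -/

/-- A threshold profile with `k ≤ 1` is realized by an equilibrium of a threshold scheme: manual
creation is `k - a / r` for `r ≥ ρ`, and the compensation makes its revenue equal to `θ`. -/
theorem exists_equilibrium_of_profile (hX : IsCompact X) (hp : IsProbDensity p)
    (hg : IsProbDensity g) {l u : ℝ} (h : IsAtomlessRatio (densityMeasure g) (ratio p g) l u)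
    {α γ c a ρ k θ : ℝ} (hα : 0 < α) (hγ : γ ≤ 1) (hc : 0 < c)
    (hprof : IsThresholdProfile (densityMeasure g) (ratio p g) α γ c l u a ρ k θ) (hk : k ≤ 1) :
    ∃ (w : ℝ≥0) (β : X → CreationAction → ℝ) (q : ContentDensity X),
      IsEquilibrium p g α γ c
        (fun x _ => Set.indicator {y : X | ρ ≤ ratio p g y} (fun _ => w) x) β q ∧
      platformProfit p α γ (fun x _ => Set.indicator {y : X | ρ ≤ ratio p g y} (fun _ => w) x) q
        = thresholdProfit (densityMeasure g) (ratio p g) α c a ρ k θ ∧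
      (UpperSemicontinuous (ratio p g) → UpperSemicontinuous (q : X → ℝ)) := by
  obtain ⟨hρ, ha, hk0, haρ, -, -, hfeas⟩ := id hprof
  have hprob := isProbabilityMeasure_densityMeasure hg
  set ν := densityMeasure g with hν
  set r := ratio p g with hr_def
  have hρ0 : 0 < ρ := h.pos.trans_le hρ.1
  obtain ⟨Mp, hMp⟩ := hp.exists_le hX
  obtain ⟨Mg, hMg⟩ := hg.exists_le hX
  obtain ⟨mp, hmp, hmp'⟩ := hp.lower_bound
  obtain ⟨mg, hmg, hmg'⟩ := hg.lower_bound
  have hK : MeasurableSet {x | ρ ≤ r x} := measurableSet_le measurable_const h.measurable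
  have hpr : ∀ x, p x = r x * g x := fun x => (ratio_mul hg x).symm
  have har : ∀ x, ρ ≤ r x → a ≤ k * r x := fun x hx => haρ.trans (by gcongr)
  have hagkp : ∀ x, ρ ≤ r x → a * g x ≤ k * p x := fun x hx => by
    rw [hpr x, ← mul_assoc]
    exact mul_le_mul_of_nonneg_right (har x hx) (hg.pos x).le
  -- the compensation makes up for the difference between `θ` and the revenue at the level `k`
  have hw : 0 ≤ θ - (1 - γ) * k ^ (-α) := sub_nonneg.2 (h.revenue_le_of_profile hα.le hγ hprof)
  set w : ℝ≥0 := ⟨θ - (1 - γ) * k ^ (-α), hw⟩ with hw_def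
  set b : X → ℝ := fun x => if ρ ≤ r x then k - a / r x else 0 with hb
  have hbm : Measurable b :=
    Measurable.ite hK (measurable_const.sub (measurable_const.div h.measurable)) measurable_const
  have hb0 : ∀ x, 0 ≤ b x := fun x => by
    simp only [hb]; split_ifs with hx
    · rw [sub_nonneg, div_le_iff₀ (h.ratio_pos x)]; exact har x hx
    · exact le_rfl
  have hb1 : ∀ x, b x ≤ 1 := fun x => by
    simp only [hb]; split_ifs with hx
    · have := div_pos ha (h.ratio_pos x)
      linarith
    · exact zero_le_one
  set β : X → CreationAction → ℝ := fun x i =>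
    match i with
    | CreationAction.H => b x
    | CreationAction.AI => 1 - b x
    | CreationAction.O => 0 with hβ
  set q : ContentDensity X := ⟨fun x => if ρ ≤ r x then k * p x else a * g x,
    Measurable.ite hK (hp.measurable.const_mul k) (hg.measurable.const_mul a),
    ⟨a * mg, mul_pos ha hmg, fun x => by
      have e : a * mg ≤ a * g x := by gcongr; exact hmg' x
      dsimp only
      split_ifs with hx
      exacts [e.trans (hagkp x hx), e]⟩,
    ⟨k * Mp + a * Mg, fun x => by
      have e1 : k * p x ≤ k * Mp := by gcongr; exact hMp x
      have e2 : a * g x ≤ a * Mg := by gcongr; exact hMg x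
      have e3 := mul_pos hk0 (hp.pos x)
      have e4 := mul_pos ha (hg.pos x)
      dsimp only
      split_ifs <;> linarith⟩⟩ with hq
  have hqx : ∀ x, q x = if ρ ≤ r x then k * p x else a * g x := fun x => rfl
  set W : CompensationScheme X :=
    fun x _ => Set.indicator {y : X | ρ ≤ r y} (fun _ => w) x with hW
  have hWx : ∀ x, (W x q : ℝ) = if ρ ≤ r x then θ - (1 - γ) * k ^ (-α) else 0 := fun x => by
    simp only [hW, Set.indicator, Set.mem_ofPred_eq]
    split_ifs <;> rfl
  have hVx : ∀ x, compensatedRevenue p α γ W q x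
      = if ρ ≤ r x then θ else (1 - γ) * a ^ (-α) * r x ^ α := by
    intro x
    rw [compensatedRevenue, revenue, hWx, hqx]
    split_ifs with hx
    · rw [show p x / (k * p x) = k⁻¹ by have := (hp.pos x).ne'; field_simp,
        Real.inv_rpow hk0.le, ← Real.rpow_neg hk0.le]
      ring
    · rw [show p x / (a * g x) = a⁻¹ * r x by
          rw [hpr x]; have := (hg.pos x).ne'; field_simp,
        Real.mul_rpow (by positivity) (h.ratio_pos x).le, Real.inv_rpow ha.le,
        ← Real.rpow_neg ha.le]
      ring
  have hA : aiProfit p g α γ W q = θ - c := by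
    rw [aiProfit, ← integral_densityMeasure hg]
    simp_rw [hVx]
    exact h.integral_profile_revenue hα.le hprof
  have hθc : c ≤ θ := h.le_of_profile hγ hc hprof
  have hmass : ∫ y, β y CreationAction.AI * p y = a := by
    have e : (fun y => β y CreationAction.AI * p y)
        = fun y => (if ρ ≤ r y then (1 - k) * r y + a else r y) * g y := by
      ext y
      simp only [hβ, hb]
      split_ifs
      · have := (h.ratio_pos y).ne'
        rw [hpr y]; field_simp; ring
      · rw [hpr y]; ring
    rw [e, ← integral_densityMeasure hg, h.integral_profile_automated hprof]
  refine ⟨w, β, q, ⟨?_, ?_, ?_, ?_, ?_⟩, ?_, ?_⟩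
  · refine measurable_pi_iff.2 fun i => ?_
    cases i
    exacts [hbm, measurable_const.sub hbm, measurable_const]
  · refine (integrable_densityMeasure_iff hg _).1 ?_
    change Integrable (compensatedRevenue p α γ W q) ν
    rw [funext hVx]
    exact h.integrable_profile_revenue hα.le
  · intro x
    refine ⟨fun i => ?_, ?_⟩
    · cases i
      exacts [hb0 x, sub_nonneg.2 (hb1 x), le_rfl]
    · rw [sum_creationAction]; simp [hβ]
  · intro x b' hb'
    have s0 := hb'.1 CreationAction.H
    have s1 := hb'.1 CreationAction.AI
    have s2 := hb'.1 CreationAction.O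
    have s3 := hb'.2
    rw [sum_creationAction] at s3
    change b' CreationAction.H * (compensatedRevenue p α γ W q x - c)
        + b' CreationAction.AI * aiProfit p g α γ W q
      ≤ b x * (compensatedRevenue p α γ W q x - c) + (1 - b x) * aiProfit p g α γ W q
    rw [hA, hVx]
    have hVle : (if ρ ≤ r x then θ else (1 - γ) * a ^ (-α) * r x ^ α) - c ≤ θ - c := by
      split_ifs with hx
      · exact le_rfl
      · have e1 : r x ^ α ≤ ρ ^ α :=
          Real.rpow_le_rpow (h.ratio_pos x).le (not_le.1 hx).le hα.le
        have e2 := mul_le_mul_of_nonneg_left e1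
          (mul_nonneg (sub_nonneg.2 hγ) (Real.rpow_nonneg ha.le (-α)))
        linarith
    have hval : b x * ((if ρ ≤ r x then θ else (1 - γ) * a ^ (-α) * r x ^ α) - c)
        = b x * (θ - c) := by
      simp only [hb]
      split_ifs <;> simp
    have e1 := mul_le_mul_of_nonneg_left hVle s0
    have e2 := mul_nonneg s2 (sub_nonneg.2 hθc)
    nlinarith
  · intro x
    rw [hmass, hqx]
    simp only [hβ, hb]
    have := (h.ratio_pos x).ne'
    split_ifs
    · rw [hpr x]; field_simp; ring
    · ring
  · rw [platformProfit, integral_quality_eq hp hg]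
    have e1 : (fun x => r x ^ α * (q x / g x) ^ (1 - α)) = fun x =>
        if ρ ≤ r x then k ^ (1 - α) * r x else a ^ (1 - α) * r x ^ α := by
      ext x
      rw [hqx]
      have hg0 := (hg.pos x).ne'
      have hr0 := h.ratio_pos x
      split_ifs
      · rw [hpr x, show k * (r x * g x) / g x = k * r x by field_simp,
          Real.mul_rpow hk0.le hr0.le]
        have : r x ^ α * r x ^ (1 - α) = r x := by rw [← Real.rpow_add hr0]; simp
        linear_combination k ^ (1 - α) * this
      · rw [mul_div_cancel_right₀ _ hg0]; ring
    have e2 : (fun x => (W x q : ℝ) * q x) = fun x =>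
        (if ρ ≤ r x then (θ - (1 - γ) * k ^ (-α)) * k * r x else 0) * g x := by
      ext x
      rw [hWx, hqx]
      split_ifs
      · rw [hpr x]; ring
      · simp
    rw [e1, e2, ← integral_densityMeasure hg, h.profile_profit_eq hα.le hprof]
  · intro husc x y hy
    rw [hqx] at hy
    have hkp : k * p x < y → ∀ᶠ z in nhds x, k * p z < y := fun hlt => by
      filter_upwards [hp.upperSemicontinuous x (y / k) ((lt_div_iff₀' hk0).2 hlt)] with z hz
      exact (lt_div_iff₀' hk0).1 hz
    have hag : a * g x < y → ∀ᶠ z in nhds x, a * g z < y := fun hlt => by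
      filter_upwards [hg.upperSemicontinuous x (y / a) ((lt_div_iff₀' ha).2 hlt)] with z hz
      exact (lt_div_iff₀' ha).1 hz
    split_ifs at hy with hx
    · filter_upwards [hkp hy, hag ((hagkp x hx).trans_lt hy)] with z h1 h2
      rw [hqx]
      split_ifs
      exacts [h1, h2]
    · filter_upwards [hag hy, husc x ρ (not_le.1 hx)] with z h1 h2
      rwa [hqx, if_neg (not_le.2 h2)]

end

/-! ### Equilibria are dominated by threshold profiles -/

section

variable {d : ℕ} {X : Set (EuclideanSpace ℝ (Fin d))} {p g : X → ℝ}

/-- If GenAI is profitable, then nobody takes the outside option, and manual creation is used only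
where its revenue is at least the profit from GenAI plus `c`. -/
theorem creator_optimal {α γ c : ℝ} {W : CompensationScheme X} {q : ContentDensity X} {x : X}
    {b : CreationAction → ℝ} (hb : b ∈ stdSimplex ℝ CreationAction)
    (hmax : IsMaxOn (creatorProfit p g α γ c W q x) (stdSimplex ℝ CreationAction) b)
    (hA : 0 < aiProfit p g α γ W q) :
    b CreationAction.AI = 1 - b CreationAction.H ∧ (0 < b CreationAction.H →
      aiProfit p g α γ W q + c ≤ compensatedRevenue p α γ W q x) := by
  have s0 := hb.1 CreationAction.H
  have s1 := hb.1 CreationAction.AI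
  have s2 := hb.1 CreationAction.O
  have s3 := hb.2
  rw [sum_creationAction] at s3
  have hvH : (fun i => match i with
      | CreationAction.H => (1 : ℝ) | CreationAction.AI => 0 | CreationAction.O => 0)
      ∈ stdSimplex ℝ CreationAction :=
    ⟨fun i => by cases i <;> simp, by rw [sum_creationAction]; simp⟩
  have hvA : (fun i => match i with
      | CreationAction.H => (0 : ℝ) | CreationAction.AI => 1 | CreationAction.O => 0)
      ∈ stdSimplex ℝ CreationAction :=
    ⟨fun i => by cases i <;> simp, by rw [sum_creationAction]; simp⟩
  have e1 := hmax hvH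
  have e2 := hmax hvA
  simp only [creatorProfit, manualProfit, one_mul, zero_mul, add_zero, zero_add,
    Set.mem_ofPred_eq] at e1 e2
  set A := aiProfit p g α γ W q
  set U := compensatedRevenue p α γ W q x - c with hU
  constructor
  · by_contra hne
    have hO : 0 < b CreationAction.O := lt_of_le_of_ne s2 fun h0 => hne (by linarith)
    rcases le_total U A with hUA | hUA
    · nlinarith
    · nlinarith
  · intro hH
    by_contra hlt
    have hUA : U < A := by linarith
    nlinarith

/-- The profit of any equilibrium is at most that of a threshold profile. -/
theorem exists_profile_of_equilibrium (hp : IsProbDensity p)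
    (hg : IsProbDensity g) {l u : ℝ} (h : IsAtomlessRatio (densityMeasure g) (ratio p g) l u)
    {α γ c : ℝ} (hα : α ∈ Set.Ioo (0 : ℝ) 1) (hγ0 : 0 ≤ γ) (hγ : γ ≤ 2 * α / (α + 1)) (hc : 0 < c)
    {W : CompensationScheme X} {β : X → CreationAction → ℝ} {q : ContentDensity X}
    (heq : IsEquilibrium p g α γ c W β q) :
    ∃ a ρ k θ, IsThresholdProfile (densityMeasure g) (ratio p g) α γ c l u a ρ k θ ∧ k ≤ 1 ∧
      platformProfit p α γ W q ≤ thresholdProfit (densityMeasure g) (ratio p g) α c a ρ k θ := by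
  obtain ⟨hβm, hVi, hsimp, hopt, hcons⟩ := heq
  have hα' := hα
  obtain ⟨h0, h1⟩ := hα'
  have hγ1 : γ < 1 := hγ.trans_lt ((div_lt_one (by linarith)).2 (by linarith))
  have hprob := isProbabilityMeasure_densityMeasure hg
  have hVi := (integrable_densityMeasure_iff hg (compensatedRevenue p α γ W q)).2 hVi
  have hAV : aiProfit p g α γ W q = ∫ x, compensatedRevenue p α γ W q x ∂(densityMeasure g) :=
    (integral_densityMeasure hg _).symm
  set ν := densityMeasure g with hν
  set r := ratio p g with hr_def
  set A := aiProfit p g α γ W q with hA_def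
  set V := compensatedRevenue p α γ W q with hV_def
  have hqm := q.2.1
  obtain ⟨mq, hmq, hmq'⟩ := q.2.2.1
  obtain ⟨Mq, hMq⟩ := q.2.2.2
  obtain ⟨mg, hmg, hmg'⟩ := hg.lower_bound
  have hpr : ∀ x, p x = r x * g x := fun x => (ratio_mul hg x).symm
  have hq0 : ∀ x, 0 < q x := fun x => hmq.trans_le (hmq' x)
  have hV0 : ∀ x, 0 < V x := fun x => by
    have : 0 < (1 - γ) * (p x / q x) ^ α :=
      mul_pos (by linarith) (Real.rpow_pos_of_pos (div_pos (hp.pos x) (hq0 x)) α)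
    exact add_pos_of_pos_of_nonneg this (W x q).2
  have hA0 : 0 < A := by
    rw [hAV, integral_pos_iff_support_of_nonneg (fun x => (hV0 x).le) hVi,
      Function.support_eq_univ fun x => (hV0 x).ne']
    simp
  have hbest := fun x => creator_optimal (hsimp x) (hopt x) hA0
  set b : X → ℝ := fun x => β x CreationAction.H with hb_def
  have hbm : Measurable b := (measurable_pi_apply _).comp hβm
  have hb0 : ∀ x, 0 ≤ b x := fun x => (hsimp x).1 _
  have hAI : ∀ x, β x CreationAction.AI = 1 - b x := fun x => (hbest x).1
  have hb1 : ∀ x, b x ≤ 1 := fun x => by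
    have := (hsimp x).1 CreationAction.AI
    rw [hAI] at this
    linarith
  have hbV : ∀ x, 0 < b x → A + c ≤ V x := fun x => (hbest x).2
  have hir : Integrable r ν := h.integrable_id
  have hbr : Integrable (fun x => b x * r x) ν :=
    hir.bdd_mul hbm.aestronglyMeasurable (c := 1)
      (.of_forall fun x => by rw [Real.norm_of_nonneg (hb0 x)]; exact hb1 x)
  set a := ∫ y, β y CreationAction.AI * p y with ha_def
  have ha : a = 1 - ∫ x, b x * r x ∂ν := by
    have e : (fun y => β y CreationAction.AI * p y) = fun y => (r y - b y * r y) * g y := by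
      ext y; rw [hAI, hpr]; ring
    rw [ha_def, e, ← integral_densityMeasure hg, integral_sub hir hbr, h.integral_eq_one]
  have hVle : ¬ A + c ≤ A := by linarith
  have ha0 : 0 < a := by
    have hann : 0 ≤ a := integral_nonneg fun y =>
      mul_nonneg ((hsimp y).1 _) (hp.pos y).le
    refine lt_of_le_of_ne hann fun hz => hVle ?_
    have hbpos : ∀ x, 0 < b x := fun x => by
      have e := hcons x
      rw [← hz, mul_zero, add_zero] at e
      exact (mul_pos_iff_of_pos_right (hp.pos x)).1 (by rw [← e]; exact hq0 x)
    calc A + c = ∫ _, (A + c) ∂ν := by simp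
      _ ≤ ∫ x, V x ∂ν := integral_mono (integrable_const _) hVi fun x => hbV x (hbpos x)
      _ = A := hAV.symm
  -- the density of content relative to `g`
  set f : X → ℝ := fun x => q x / g x with hf_def
  have hfm : Measurable f := hqm.div hg.measurable
  have hf : ∀ x, f x = b x * r x + a := fun x => by
    have := (hg.pos x).ne'
    rw [hf_def]
    simp only
    rw [hcons x, hpr x]
    simp only [hb_def]
    field_simp
  have haf : ∀ x, a ≤ f x := fun x => by
    rw [hf]
    have := mul_nonneg (hb0 x) (h.ratio_pos x).le
    linarith
  have hf0 : ∀ x, 0 < f x := fun x => ha0.trans_le (haf x)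
  have hfb : ∀ x, f x ≤ Mq / mg := fun x =>
    div_le_div₀ ((hq0 x).le.trans (hMq x)) (hMq x) hmg (hmg' x)
  have hf1 : ∫ x, f x ∂ν = 1 := by
    simp_rw [hf]
    rw [integral_add hbr (integrable_const _), ha]
    simp
  have hfpos : ∀ x, a < f x ↔ 0 < b x := fun x => by
    rw [hf, lt_add_iff_pos_left, mul_pos_iff_of_pos_right (h.ratio_pos x)]
  have hBm : MeasurableSet {x | a < f x} := measurableSet_lt measurable_const hfm
  have hW : ∀ x, (W x q : ℝ) = V x - (1 - γ) * (r x / f x) ^ α := fun x => by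
    have e : r x / f x = p x / q x := by
      have := (hg.pos x).ne'
      have := (hq0 x).ne'
      rw [hpr x, hf_def]
      simp only
      field_simp
    rw [e, hV_def, compensatedRevenue, revenue]
    ring
  have hrα := h.integrable_rpow h0.le
  have hθ : c + (1 - γ) * a ^ (-α) * ∫ x in {x | a < f x}ᶜ, r x ^ α ∂ν
      ≤ (A + c) * ν.real {x | a < f x}ᶜ := by
    have e1 : (A + c) * ν.real {x | a < f x} ≤ ∫ x in {x | a < f x}, V x ∂ν := by
      rw [mul_comm, ← smul_eq_mul, ← setIntegral_const]
      exact setIntegral_mono_on (integrable_const _) hVi.integrableOn hBm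
        fun x hx => hbV x ((hfpos x).1 hx)
    have e2 : (1 - γ) * a ^ (-α) * ∫ x in {x | a < f x}ᶜ, r x ^ α ∂ν
        ≤ ∫ x in {x | a < f x}ᶜ, V x ∂ν := by
      rw [← integral_const_mul]
      refine setIntegral_mono_on (hrα.const_mul _).integrableOn hVi.integrableOn hBm.compl
        fun x hx => ?_
      have hfa : f x = a := le_antisymm (not_lt.1 hx) (haf x)
      have hw : (0 : ℝ) ≤ W x q := (W x q).2
      rw [hW, hfa, Real.div_rpow (h.ratio_pos x).le ha0.le] at hw
      rw [Real.rpow_neg ha0.le, mul_assoc, inv_mul_eq_div]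
      linarith
    have e3 := integral_add_compl hBm hVi
    have e4 : ν.real {x | a < f x}ᶜ = 1 - ν.real {x | a < f x} := probReal_compl_eq_one_sub hBm
    rw [← hAV] at e3
    rw [e4]
    linarith
  have hs : 0 < ν.real {x | a < f x}ᶜ := by
    refine lt_of_le_of_ne measureReal_nonneg fun hz => ?_
    have e1 : 0 ≤ (1 - γ) * a ^ (-α) * ∫ x in {x | a < f x}ᶜ, r x ^ α ∂ν :=
      mul_nonneg (mul_nonneg (by linarith) (Real.rpow_nonneg ha0.le _))
        (setIntegral_nonneg hBm.compl fun x _ => Real.rpow_nonneg (h.ratio_pos x).le α)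
    rw [← hz, mul_zero] at hθ
    linarith
  have hCi : Integrable (fun x => r x ^ α * f x ^ (1 - α)) ν := by
    refine hrα.mul_bdd (c := (Mq / mg) ^ (1 - α)) (hfm.pow_const _).aestronglyMeasurable
      (.of_forall fun x => ?_)
    rw [Real.norm_of_nonneg (Real.rpow_nonneg (hf0 x).le _)]
    exact Real.rpow_le_rpow (hf0 x).le (hfb x) (by linarith)
  have hVf : Integrable (fun x => V x * f x) ν :=
    hVi.mul_bdd (c := Mq / mg) hfm.aestronglyMeasurable (.of_forall fun x => by
      rw [Real.norm_of_nonneg (hf0 x).le]; exact hfb x)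
  have hWf : ∀ x, (W x q : ℝ) * f x = V x * f x - (1 - γ) * (r x ^ α * f x ^ (1 - α)) := fun x => by
    have e : f x ^ (1 - α) = f x / f x ^ α := by
      rw [Real.rpow_sub (hf0 x), Real.rpow_one]
    rw [hW, Real.div_rpow (h.ratio_pos x).le (hf0 x).le, e]
    ring
  have hprofit : platformProfit p α γ W q
      = γ * ∫ x, r x ^ α * f x ^ (1 - α) ∂ν - ∫ x, (W x q : ℝ) * f x ∂ν := by
    have e : (fun x => (W x q : ℝ) * q x) = fun x => (W x q : ℝ) * f x * g x := by
      ext x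
      rw [mul_assoc, div_mul_cancel₀ _ (hg.pos x).ne']
    rw [platformProfit, integral_quality_eq hp hg, e, ← integral_densityMeasure hg]
  refine h.exists_profile_ge hα hγ0 hγ hc ha0 hfm haf hfb hf1 hs hθ ?_ ?_
  · rw [hprofit]
    have : 0 ≤ ∫ x, (W x q : ℝ) * f x ∂ν :=
      integral_nonneg fun x => mul_nonneg (W x q).2 (hf0 x).le
    linarith
  · -- creators as a whole earn at least `A + c - c a`, since those who create manually earn `A + c`
    have e1 : A + c - c * a ≤ ∫ x, V x * f x ∂ν := by
      have e2 : ∫ x, ((A + c) * (b x * r x) + a * V x) ∂ν = A + c - c * a := by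
        rw [integral_add (hbr.const_mul _) (hVi.const_mul _), integral_const_mul,
          integral_const_mul, ← hAV, show ∫ x, b x * r x ∂ν = 1 - a by linarith]
        ring
      rw [← e2]
      refine integral_mono ((hbr.const_mul _).add (hVi.const_mul _)) hVf fun x => ?_
      simp only
      rw [hf]
      rcases (hb0 x).eq_or_lt with hz | hz
      · rw [← hz]; linarith
      · have := mul_le_mul_of_nonneg_right (hbV x hz) (mul_nonneg (hb0 x) (h.ratio_pos x).le)
        linarith
    have e3 : ∫ x, (W x q : ℝ) * f x ∂ν
        = ∫ x, V x * f x ∂ν - (1 - γ) * ∫ x, r x ^ α * f x ^ (1 - α) ∂ν := by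
      simp_rw [hWf]
      rw [integral_sub hVf (hCi.const_mul _), integral_const_mul]
    rw [hprofit, e3]
    linarith

end

theorem mainTheorem1 {d : ℕ} {X : Set (EuclideanSpace ℝ (Fin d))} (hX : IsCompact X)
    (p g : X → ℝ) (hp : IsProbDensity p) (hg : IsProbDensity g)
    (α γ c : ℝ) (hα : α ∈ Set.Ioo (0 : ℝ) 1) (hγ : γ ∈ Set.Icc (0 : ℝ) 1) (hc : 0 < c)
    (hr : HasPDF (ratio p g) (densityMeasure p) volume)
    (hαγ : γ ≤ 2 * α / (α + 1))
    (W' : CompensationScheme X) (β' : X → CreationAction → ℝ) (q' : ContentDensity X)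
    (heq : IsEquilibrium p g α γ c W' β' q') :
    ∃ W : CompensationScheme X, IsXBased W ∧
      (∃ ρ ∈ Set.Icc (⨅ x, ratio p g x) (⨆ x, ratio p g x), ∃ w : ℝ≥0,
        ∀ (x : X) (q : ContentDensity X),
          W x q = Set.indicator {y : X | ρ ≤ ratio p g y} (fun _ => w) x) ∧
      ∃ (β : X → CreationAction → ℝ) (q : ContentDensity X),
        IsEquilibrium p g α γ c W β q ∧
        platformProfit p α γ W' q' ≤ platformProfit p α γ W q ∧
        (UpperSemicontinuous (ratio p g) → UpperSemicontinuous (q : X → ℝ)) := by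
  have h := isAtomlessRatio_ratio hX hp hg hr
  obtain ⟨a, ρ, k, θ, hprof, hk, hle⟩ :=
    exists_profile_of_equilibrium hp hg h hα hγ.1 hαγ hc heq
  obtain ⟨w, β, q, hE, hprofit, husc⟩ :=
    exists_equilibrium_of_profile hX hp hg h hα.1 hγ.2 hc hprof hk
  exact ⟨_, fun _ _ _ => rfl, ⟨ρ, hprof.mem, w, fun _ _ => rfl⟩, β, q, hE,
    hle.trans hprofit.ge, husc⟩
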